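/- Let $M$ be a von Neumann algebra with a faithful normal tracial state $\tau$, let $L^1(M,\tau)$ be the completion of $M$ for $\|x\|_1=\tau(|x|)$, and assume that $L^1(M,\tau)$ is separable. Let $S=\{x\in L^1(M,\tau)_+:\tau(x)=1\}$. For $x,y\in S$ put $m(x,y)=\max\{\lambda\in\mathbb R:\lambda y\le x\}$ and $d(x,y)=\frac{1-m(x,y)m(y,x)}{1+m(x,y)m(y,x)}$. A positive linear map $\gamma$ on $L^1(M,\tau)$ is faithful if $x\ge 0$ and $\gamma(x)=0$ imply $x=0$; for such $\gamma$ put $\gamma\cdot x=\gamma(x)/\tau(\gamma(x))$ for $x\in S$ and $$c(\gamma)=\sup_{x\ne y\in S}\frac{d(\gamma\cdot x,\gamma\cdot y)}{d(x,y)}$$ (with $c(\gamma)=0$ if $S$ is a single point). We say that $\gamma$ is a strict Hennion contraction, $\gamma\in SHC(M)$, if $c(\gamma)<1$. Let $(\Omega,\mathcal F,\mathbb P)$ be a probability space, let $T:\Omega\to\Omega$ be an ergodic measure-preserving bijection with measurable inverse, and let $\gamma_\omega$, $\omega\in\Omega$, be a bounded positive faithful random linear operator on $L^1(M,\tau)$: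 for every $x\in L^1(M,\tau)$ the map $\omega\mapsto\gamma_\omega(x)$ is strongly measurable (almost surely a norm limit of simple functions), and for almost every $\omega$ the map $\gamma_\omega$ is linear, bounded, positive and faithful. For integers $n\ge m$ let $$\Gamma_{n,m}(\omega)=\gamma_{T^n\omega}\circ\gamma_{T^{n-1}\omega}\circ\cdots\circ\gamma_{T^m\omega}.$$ Suppose that $$\mathbb P[\exists\, n,m\in\mathbb Z:\ n\ge m\text{ and }\Gamma_{n,m}\in SHC(M)]>0.$$ 1. There is a constant $C\in[0,1)$ such that for every $m\in\mathbb Z$, almost surely, $\lim_{n\to+\infty}c(\Gamma_{n,m})^{\frac1{n-m+1}}=C$, and for every $n\in\mathbb Z$, almost surely, $\lim_{m\to-\infty}c(\Gamma_{n,m})^{\frac1{n-m+1}}=C$. 2. For every $\kappa\in(C,1)$ there are almost surely finite random variables $D_{\bullet,k}$ and $D_{k,\bullet}$, $k\in\mathbb Z$, with $D_{\bullet,k}(T^\ell\omega)=D_{\bullet,k+\ell}(\omega)$ and $D_{k,\bullet}(T^\ell\omega)=D_{k+\ell,\bullet}(\omega)$ for all $k,\ell\in\mathbb Z$, such that almost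 surely, for all $n\ge k\ge m$, $$c(\Gamma_{n,k})\le D_{\bullet,k}\,\kappa^{n-k+1},\qquad c(\Gamma_{k,m})\le D_{k,\bullet}\,\kappa^{k-m+1}.$$ In particular, for every $k$, almost surely $c(\Gamma_{n,k})\to0$ and $c(\Gamma_{k,m})\to0$ exponentially fast as $n\to+\infty$ and $m\to-\infty$. 3. For every $k\in\mathbb Z$, the time $\nu(\Gamma_{\bullet,k})=\min\{n\ge k:\Gamma_{n,k}\in SHC(M)\}$ is an almost surely finite stopping time for the filtration $\mathcal F^+(n,k)=\sigma(c(\Gamma_{j,k}):k\le j\le n)$, $n\ge k$. Likewise, with time running downwards from $k$, the first time $\nu(\Gamma_{k,\bullet})=\max\{m\le k:\Gamma_{k,m}\in SHC(M)\}$ is an almost surely finite stopping time for the filtration $\mathcal F^-(k,m)=\sigma(c(\Gamma_{k,j}):m\le j\le k)$, $m\le k$. (Where the set is empty, the time is $\infty$. On the null event where $\Gamma_{n,m}$ is not a faithful positive linear map, $c(\Gamma_{n,m})$ is set to $1$; these $\sigma$-algebras are contained in the $\mathbb P$-completion of $\mathcal F$.) -/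

import Mathlib

open MeasureTheory Filter Topology
open scoped ComplexOrder

namespace Hennion

/-! ### Tracial von Neumann algebras and the space `L¹(M, τ)` -/

section TracialAlgebra

variable {M : Type*} [CStarAlgebra M] [PartialOrder M] [StarOrderedRing M]

/-- The positive linear functional `τ` is a faithful normal tracial state. Normality is order
continuity: `τ` preserves suprema of increasing nets of positive elements. -/
structure IsFaithfulNormalTracialState (τ : M →ₚ[ℂ] ℂ) : Prop where
  map_one : τ 1 = 1
  tracial : ∀ a b : M, τ (a * b) = τ (b * a)
  faithful : ∀ a : M, 0 ≤ a → τ a = 0 → a = 0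
  normal : ∀ (s : Set M) (a : M), s.Nonempty → (∀ b ∈ s, 0 ≤ b) → DirectedOn (· ≤ ·) s →
    IsLUB s a → IsLUB ((fun b => (τ b).re) '' s) (τ a).re

/-- The embedding `x ↦ τ(x ·)` of `M` into its dual. -/
noncomputable def traceEmbedding (τ : M →ₚ[ℂ] ℂ) : M →ₗ[ℂ] StrongDual ℂ M where
  toFun x := (⟨τ.toLinearMap, map_continuous τ⟩ : M →L[ℂ] ℂ) ∘L ContinuousLinearMap.mul ℂ M x
  map_add' x y := by ext a; simp
  map_smul' c x := by ext a; simp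

theorem traceEmbedding_apply (τ : M →ₚ[ℂ] ℂ) (x a : M) : traceEmbedding τ x a = τ (x * a) := rfl

/-- `L¹(M, τ)`, the completion of `M` for the norm `‖x‖₁ = τ(|x|)`, realized inside the dual of
`M` by identifying `x` with the functional `a ↦ τ(x a)`. This identification is isometric on `M`
by `norm_traceEmbedding` below, so that the completion is the norm closure of the image of `M`.
For `x : L1 τ` and `a : M` the value `(x : StrongDual ℂ M) a` is the pairing `τ(x a)`. -/
noncomputable abbrev L1 (τ : M →ₚ[ℂ] ℂ) : Submodule ℂ (StrongDual ℂ M) :=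
  (LinearMap.range (traceEmbedding τ)).topologicalClosure

/-- The functional `τ` on `L¹(M, τ)`. -/
noncomputable def L1.trace {τ : M →ₚ[ℂ] ℂ} (x : L1 τ) : ℂ := (x : StrongDual ℂ M) 1

/-- The positive cone of `L¹(M, τ)`: those `x` with `τ(x a) ≥ 0` for all `a ∈ M₊`. -/
def L1.IsPos {τ : M →ₚ[ℂ] ℂ} (x : L1 τ) : Prop :=
  ∀ a : M, 0 ≤ a → 0 ≤ (x : StrongDual ℂ M) a

end TracialAlgebra

section Norm

variable {M : Type*} [CStarAlgebra M] [PartialOrder M] [StarOrderedRing M]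

/-- Approximate polar decomposition. -/
theorem exists_approx_polar (a : M) {ε : ℝ} (hε : 0 < ε) :
    ∃ r : M, IsSelfAdjoint r ∧ Commute r (CFC.abs a) ∧
      r * CFC.abs a + (ε : ℂ) • r = 1 ∧ ‖r * CFC.abs a‖ ≤ 1 := by
  set h := CFC.abs a with hh
  have h0 : 0 ≤ h := CFC.abs_nonneg a
  have hsa : IsSelfAdjoint h := h0.isSelfAdjoint
  have hsp : ∀ t ∈ spectrum ℝ h, 0 ≤ t := fun t ht => spectrum_nonneg_of_nonneg h0 ht
  have hc : ContinuousOn (fun t : ℝ => (t + ε)⁻¹) (spectrum ℝ h) := by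
    refine ContinuousOn.inv₀ (by fun_prop) fun t ht => ?_
    have := hsp t ht
    positivity
  have hmul : cfc (fun t : ℝ => (t + ε)⁻¹) h * h = cfc (fun t : ℝ => (t + ε)⁻¹ * t) h := by
    conv_lhs => rw [← cfc_id' ℝ h]
    rw [cfc_id' ℝ h, cfc_mul (fun t : ℝ => (t + ε)⁻¹) (fun t => t) h hc (by fun_prop),
      cfc_id' ℝ h]
  refine ⟨cfc (fun t : ℝ => (t + ε)⁻¹) h, cfc_predicate _ h, ?_, ?_, ?_⟩
  · have := cfc_commute_cfc (fun t : ℝ => (t + ε)⁻¹) (fun t => t) h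
    rwa [cfc_id' ℝ h] at this
  · rw [hmul]
    have : ((ε : ℂ) • cfc (fun t : ℝ => (t + ε)⁻¹) h) = cfc (fun t : ℝ => ε * (t + ε)⁻¹) h := by
      rw [cfc_const_mul ε _ h hc, Complex.coe_smul]
    rw [this, ← cfc_add h (fun t : ℝ => (t + ε)⁻¹ * t) (fun t : ℝ => ε * (t + ε)⁻¹)
      (hc.mul continuousOn_id) (continuousOn_const.mul hc), ← cfc_one ℝ h]
    refine cfc_congr fun t ht => ?_
    have := hsp t ht
    have : t + ε ≠ 0 := by positivity
    simp only [Pi.one_apply]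
    field_simp
  · rw [hmul]
    refine norm_cfc_le zero_le_one fun t ht => ?_
    have := hsp t ht
    rw [Real.norm_eq_abs, abs_of_nonneg (by positivity), inv_mul_le_iff₀ (by positivity)]
    linarith

theorem norm_trace_conj_le (τ : M →ₚ[ℂ] ℂ) (s y : M) :
    ‖τ (star s * (y * s))‖ ≤ ‖y‖ * (τ (star s * s)).re := by
  have h1 : ‖τ.leftMulMapPreGNS y‖ ≤ ‖y‖ :=
    LinearMap.mkContinuous_norm_le _ (norm_nonneg y) _
  have h2 := norm_inner_le_norm (𝕜 := ℂ) (τ.toPreGNS s) (τ.leftMulMapPreGNS y (τ.toPreGNS s))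
  have h3 : ‖τ.toPreGNS s‖ ^ 2 = (τ (star s * s)).re := by
    have := τ.preGNS_norm_sq (τ.toPreGNS s)
    rw [PositiveLinearMap.ofPreGNS_toPreGNS] at this
    rw [← this]
    norm_cast
  rw [← h3]
  have h4 := (τ.leftMulMapPreGNS y).le_of_opNorm_le h1 (τ.toPreGNS s)
  calc ‖τ (star s * (y * s))‖ ≤ ‖τ.toPreGNS s‖ * ‖τ.leftMulMapPreGNS y (τ.toPreGNS s)‖ := h2
    _ ≤ ‖τ.toPreGNS s‖ * (‖y‖ * ‖τ.toPreGNS s‖) := by gcongr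
    _ = _ := by ring

/-- The dual norm of `a ↦ τ(x a)` is `‖x‖₁ = τ(|x|)`. -/
theorem norm_traceEmbedding {τ : M →ₚ[ℂ] ℂ} (hτ : IsFaithfulNormalTracialState τ) (x : M) :
    ‖traceEmbedding τ x‖ = (τ (CFC.abs x)).re := by
  have limit : ∀ A B K : ℝ, (∀ ε : ℝ, 0 < ε → A ≤ B + ε * K) → A ≤ B := by
    intro A B K hAB
    have h1 : Tendsto (fun ε : ℝ => B + ε * K) (𝓝[>] 0) (𝓝 (B + 0 * K)) :=
      ((continuous_const.add (continuous_id.mul continuous_const)).tendsto 0).mono_left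
        nhdsWithin_le_nhds
    have h2 := ge_of_tendsto h1 (eventually_nhdsWithin_of_forall fun ε hε => hAB ε hε)
    simpa using h2
  set τc : M →L[ℂ] ℂ := ⟨τ.toLinearMap, map_continuous τ⟩ with hτc
  have hτle : ∀ a : M, ‖τ a‖ ≤ ‖τc‖ * ‖a‖ := fun a => τc.le_opNorm a
  set h := CFC.abs x with hh
  have h0 : 0 ≤ h := CFC.abs_nonneg x
  have hsa : star h = h := h0.isSelfAdjoint
  have hhx : h * h = star x * x := CFC.abs_mul_abs x
  have hpos : 0 ≤ (τ h).re := (Complex.nonneg_iff.1 (τ.map_nonneg h0)).1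
  have hu : ∀ r : M, IsSelfAdjoint r → Commute r h → ‖r * h‖ ≤ 1 → ‖x * r‖ ≤ 1 := by
    intro r hr hrc hrn
    have : ‖x * r‖ * ‖x * r‖ ≤ 1 := by
      rw [← CStarRing.norm_star_mul_self]
      have : star (x * r) * (x * r) = (r * h) * (r * h) := by
        rw [star_mul, hr.star_eq, mul_assoc, ← mul_assoc (star x), ← hhx, hrc.eq]
        simp only [mul_assoc]
        rw [← mul_assoc r h, hrc.eq]
        simp only [mul_assoc]
      rw [this]
      calc ‖r * h * (r * h)‖ ≤ ‖r * h‖ * ‖r * h‖ := norm_mul_le _ _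
        _ ≤ 1 := mul_le_one₀ hrn (norm_nonneg _) hrn
    nlinarith [norm_nonneg (x * r)]
  refine le_antisymm ?_ ?_
  · refine ContinuousLinearMap.opNorm_le_bound _ hpos fun b => ?_
    refine limit _ _ (‖τc‖ * ‖b‖) fun ε hε => ?_
    obtain ⟨r, hr, hrc, hr1, hrn⟩ := exists_approx_polar x hε
    have hun := hu r hr hrc hrn
    set s := CFC.sqrt h with hs
    have hss : s * s = h := CFC.sqrt_mul_sqrt_self h
    have hssa : star s = s := (CFC.sqrt_nonneg h).isSelfAdjoint
    have hx : x * b = (x * r * s) * (s * b) + (ε : ℂ) • (x * r * b) := by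
      have : x * b = x * (r * h + (ε : ℂ) • r) * b := by rw [hr1, mul_one]
      rw [this, ← hss]
      simp only [mul_add, add_mul, mul_smul_comm, smul_mul_assoc, mul_assoc]
    rw [traceEmbedding_apply, hx, map_add, hτ.tracial, map_smul]
    have e1 : s * b * (x * r * s) = star s * ((b * (x * r)) * s) := by
      rw [hssa]; simp only [mul_assoc]
    have e2 : ‖τ (s * b * (x * r * s))‖ ≤ (τ h).re * ‖b‖ := by
      rw [e1]
      refine (norm_trace_conj_le τ s _).trans ?_
      rw [hssa, hss, mul_comm]
      refine mul_le_mul_of_nonneg_left ?_ hpos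
      calc ‖b * (x * r)‖ ≤ ‖b‖ * ‖x * r‖ := norm_mul_le _ _
        _ ≤ ‖b‖ * 1 := by gcongr
        _ = ‖b‖ := mul_one _
    have e3 : ‖(ε : ℂ) • τ (x * r * b)‖ ≤ ε * (‖τc‖ * ‖b‖) := by
      rw [norm_smul, Complex.norm_real, Real.norm_of_nonneg hε.le]
      refine mul_le_mul_of_nonneg_left ((hτle _).trans ?_) hε.le
      refine mul_le_mul_of_nonneg_left ?_ (norm_nonneg _)
      calc ‖x * r * b‖ ≤ ‖x * r‖ * ‖b‖ := norm_mul_le _ _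
        _ ≤ 1 * ‖b‖ := by gcongr
        _ = ‖b‖ := one_mul _
    exact (norm_add_le _ _).trans (add_le_add e2 e3)
  · refine limit _ _ ‖τc‖ fun ε hε => ?_
    obtain ⟨r, hr, hrc, hr1, hrn⟩ := exists_approx_polar x hε
    have hun := hu r hr hrc hrn
    have e1 : h = (r * star x) * x + (ε : ℂ) • (r * h) := by
      have : h = (r * h + (ε : ℂ) • r) * h := by rw [hr1, one_mul]
      rw [add_mul, mul_assoc r h h, hhx, smul_mul_assoc, ← mul_assoc] at this
      exact this
    have e2 : τ h = traceEmbedding τ x (r * star x) + (ε : ℂ) • τ (r * h) := by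
      rw [traceEmbedding_apply, hτ.tracial x, ← map_smul, ← map_add, ← e1]
    have e3 : ‖traceEmbedding τ x (r * star x)‖ ≤ ‖traceEmbedding τ x‖ := by
      have hn : ‖r * star x‖ ≤ 1 := by
        rw [← norm_star, star_mul, star_star, hr.star_eq]; exact hun
      calc _ ≤ ‖traceEmbedding τ x‖ * ‖r * star x‖ := ContinuousLinearMap.le_opNorm _ _
        _ ≤ ‖traceEmbedding τ x‖ * 1 := by gcongr
        _ = _ := mul_one _
    have e4 : ‖(ε : ℂ) • τ (r * h)‖ ≤ ε * ‖τc‖ := by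
      rw [norm_smul, Complex.norm_real, Real.norm_of_nonneg hε.le]
      refine mul_le_mul_of_nonneg_left ((hτle _).trans ?_) hε.le
      calc ‖τc‖ * ‖r * h‖ ≤ ‖τc‖ * 1 := by gcongr
        _ = _ := mul_one _
    calc (τ h).re ≤ ‖τ h‖ := Complex.re_le_norm _
      _ ≤ ‖traceEmbedding τ x‖ + ε * ‖τc‖ := by
        rw [e2]; exact (norm_add_le _ _).trans (add_le_add e3 e4)

end Norm

/-! ### The Hennion metric and Hennion contractions -/

section Metric

variable {M : Type*} [CStarAlgebra M] [PartialOrder M] [StarOrderedRing M] {τ : M →ₚ[ℂ] ℂ}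

/-- The normal state space `S = {x ∈ L¹(M, τ)₊ : τ(x) = 1}`. -/
def normalStates (τ : M →ₚ[ℂ] ℂ) : Set (L1 τ) := {x | L1.IsPos x ∧ L1.trace x = 1}

/-- `m(x, y) = max {t ∈ ℝ : t y ≤ x}`. -/
noncomputable def mQuantity (x y : L1 τ) : ℝ := sSup {t : ℝ | L1.IsPos (x - (t : ℂ) • y)}

/-- The Hennion metric on the normal state space. -/
noncomputable def hennionDist (x y : L1 τ) : ℝ :=
  (1 - mQuantity x y * mQuantity y x) / (1 + mQuantity x y * mQuantity y x)

/-- Faithful positive linear maps on `L¹(M, τ)`. -/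
structure IsFaithfulPositive (f : L1 τ → L1 τ) : Prop where
  isLinearMap : IsLinearMap ℂ f
  map_pos : ∀ x, L1.IsPos x → L1.IsPos (f x)
  faithful : ∀ x, L1.IsPos x → f x = 0 → x = 0

/-- The projective action `f · x = f(x) / τ(f(x))`. -/
noncomputable def projAction (f : L1 τ → L1 τ) (x : L1 τ) : L1 τ := (L1.trace (f x))⁻¹ • f x

open Classical in
/-- The Hennion contraction constant of a faithful positive linear map. It is undefined for other
maps, which get the value `1`, the value of a map that does not contract. -/
noncomputable def contractionConst (f : L1 τ → L1 τ) : ℝ :=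
  if IsFaithfulPositive f then
    sSup {r : ℝ | ∃ x ∈ normalStates τ, ∃ y ∈ normalStates τ, x ≠ y ∧
      r = hennionDist (projAction f x) (projAction f y) / hennionDist x y}
  else 1

/-- Strict Hennion contractions, the class `SHC(M)`. -/
def IsSHC (f : L1 τ → L1 τ) : Prop := IsFaithfulPositive f ∧ contractionConst f < 1

end Metric

/-! ### Ergodic quantum processes -/

section Dynamics

variable {M : Type*} [CStarAlgebra M] [PartialOrder M] [StarOrderedRing M] {τ : M →ₚ[ℂ] ℂ}
variable {Ω : Type*} [MeasurableSpace Ω]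

/-- Bounded positive faithful random linear operators on `L¹(M, τ)`: each `ω ↦ γ ω x` is a random
variable in the Banach space `L¹(M, τ)` (almost surely a limit of simple functions), and almost
every `γ ω` is a bounded positive faithful linear map. -/
structure IsRandomOperator (P : Measure Ω) (γ : Ω → L1 τ → L1 τ) : Prop where
  measurable : ∀ x, AEStronglyMeasurable (fun ω => γ ω x) P
  faithfulPositive : ∀ᵐ ω ∂P, IsFaithfulPositive (γ ω)
  bounded : ∀ᵐ ω ∂P, ∃ K : ℝ, ∀ x, ‖γ ω x‖ ≤ K * ‖x‖

/-- The integer powers of an automorphism of `Ω`. -/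
def autPow (T : Ω ≃ᵐ Ω) (n : ℤ) (ω : Ω) : Ω := ((T.toEquiv : Equiv.Perm Ω) ^ n) ω

/-- `γ_{T^(m+j) ω} ∘ ⋯ ∘ γ_{T^m ω}`. -/
def quantumProcessAux (T : Ω ≃ᵐ Ω) (γ : Ω → L1 τ → L1 τ) (m : ℤ) (ω : Ω) : ℕ → L1 τ → L1 τ
  | 0 => γ (autPow T m ω)
  | j + 1 => γ (autPow T (m + (j + 1)) ω) ∘ quantumProcessAux T γ m ω j

/-- The interval quantum process `Γ_{n,m}(ω) = γ_{T^n ω} ∘ ⋯ ∘ γ_{T^m ω}`, for `m ≤ n`. -/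
def quantumProcess (T : Ω ≃ᵐ Ω) (γ : Ω → L1 τ → L1 τ) (n m : ℤ) (ω : Ω) : L1 τ → L1 τ :=
  quantumProcessAux T γ m ω (n - m).toNat

/-- The `σ`-algebra of the completion of `(Ω, P)`. Properties of `γ` hold only almost surely, so
the contraction constants are measurable up to null sets. -/
@[reducible] def completedSpace (P : Measure Ω) : MeasurableSpace Ω :=
  (inferInstance : MeasurableSpace (NullMeasurableSpace Ω P))

/-- `𝓕⁺(n, k) = σ(c(Γ_{j,k}) : k ≤ j ≤ n)`. -/
@[reducible] noncomputable def sigmaPlus (T : Ω ≃ᵐ Ω) (γ : Ω → L1 τ → L1 τ) (n k : ℤ) : MeasurableSpace Ω :=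
  ⨆ j ∈ Set.Icc k n, (borel ℝ).comap fun ω => contractionConst (quantumProcess T γ j k ω)

/-- `𝓕⁻(k, m) = σ(c(Γ_{k,j}) : m ≤ j ≤ k)`. -/
@[reducible] noncomputable def sigmaMinus (T : Ω ≃ᵐ Ω) (γ : Ω → L1 τ → L1 τ) (k m : ℤ) : MeasurableSpace Ω :=
  ⨆ j ∈ Set.Icc m k, (borel ℝ).comap fun ω => contractionConst (quantumProcess T γ k j ω)

/-- The first time `n ≥ k` at which `Γ_{n,k}` is a strict Hennion contraction (`⊤` if there is
none). -/
noncomputable def nuPlus (T : Ω ≃ᵐ Ω) (γ : Ω → L1 τ → L1 τ) (k : ℤ) (ω : Ω) : WithTop ℤ :=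
  sInf {x | ∃ n : ℤ, k ≤ n ∧ IsSHC (quantumProcess T γ n k ω) ∧ x = n}

/-- The first time `m ≤ k`, running downwards from `k`, at which `Γ_{k,m}` is a strict Hennion
contraction (`⊤` if there is none). Time runs backwards, so it is indexed by `ℤᵒᵈ`, where the
infimum is the largest such `m` in the usual order. -/
noncomputable def nuMinus (T : Ω ≃ᵐ Ω) (γ : Ω → L1 τ → L1 τ) (k : ℤ) (ω : Ω) : WithTop ℤᵒᵈ :=
  sInf {x | ∃ m : ℤ, m ≤ k ∧ IsSHC (quantumProcess T γ k m ω) ∧ x = (OrderDual.toDual m : ℤᵒᵈ)}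

end Dynamics

end Hennion

open Hennion

/-! The product m(x,y)m(y,x) is exp(-h) for Hilbert's projective metric h of the positive cone, so d
= tanh(h/2). For states x ≠ y, the line through them leaves the state space at two endpoints u, v
(`lineEnd`) with d(u,v) = 1, and a faithful positive f satisfies d(f·x, f·y) ≤ d(f·u, f·v) d(x,y)
(`hennionDist_projAction_le_mul`). So c(f) is at once the Lipschitz constant of the projective
action and the diameter of its image. This yields c(f ∘ g) ≤ c(f) c(g) (`contractionConst_comp_le`).
It also yields measurability: d is lower semicontinuous, so the diameter can be computed on a
countable dense set of states.

Along an orbit the constants are therefore submultiplicative, over T forwards and over T⁻¹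
backwards. Since c may vanish, its logarithm is truncated at -Kn, the subadditive ergodic theorem is
applied for each K, and the truncation is removed by an infimum over K (`ae_tendsto_expRate`). The
lower half of the ergodic theorem comes from greedily covering orbits by blocks of small growth
rate, together with a zero-one law. The upper half is reduced to Birkhoff sums, whose upper bound is
the lower half applied to a negated sum.

Forward and backward products of n factors have the same law, hence the same rate C
(`expRate_backwardConst`). If C were at least 1, all constants would almost surely equal 1, along
the whole orbit by invariance, and no product could contract strictly
(`expRate_forwardConst_lt_one`). The random constants are suprema of c_n/κ^n. The stopping times are
first times at which c < 1, and they are finite because the limit C is below 1. -/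

namespace Hennion

/-! ### The positive cone and the trace -/

section Cone

variable {M : Type*} [CStarAlgebra M] [PartialOrder M] [StarOrderedRing M] {τ : M →ₚ[ℂ] ℂ}

/-- The trace as a continuous linear functional on `L¹(M, τ)`. -/
noncomputable def L1.traceCLM (τ : M →ₚ[ℂ] ℂ) : L1 τ →L[ℂ] ℂ :=
  (ContinuousLinearMap.apply ℂ ℂ (1 : M)) ∘L (L1 τ).subtypeL

theorem L1.traceCLM_apply (x : L1 τ) : L1.traceCLM τ x = L1.trace x := rfl

theorem L1.trace_sub (x y : L1 τ) : L1.trace (x - y) = L1.trace x - L1.trace y :=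
  map_sub (L1.traceCLM τ) x y

theorem L1.sub_zero_smul (x y : L1 τ) : x - ((0 : ℝ) : ℂ) • y = x := by
  rw [Complex.ofReal_zero]
  module

theorem L1.sub_one_smul_self (x : L1 τ) : x - ((1 : ℝ) : ℂ) • x = 0 := by
  rw [Complex.ofReal_one]
  module

theorem L1.smul_sub_smul (a b c : ℂ) (x y : L1 τ) :
    a • (b • x - c • y) = (a * b) • x - (a * c) • y := by
  module

theorem L1.map_sub_smul {f : L1 τ → L1 τ} (hf : IsLinearMap ℂ f) (c : ℂ) (x y : L1 τ) :
    f (x - c • y) = f x - c • f y := by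
  have h : ∀ x y : L1 τ, x - c • y = x + (-c) • y := fun x y => by module
  rw [h, h, hf.map_add, hf.map_smul]

theorem L1.trace_smul (c : ℂ) (x : L1 τ) : L1.trace (c • x) = c * L1.trace x := by
  simp only [← traceCLM_apply, map_smul, smul_eq_mul]

theorem L1.continuous_trace : Continuous (L1.trace : L1 τ → ℂ) := (L1.traceCLM τ).continuous

theorem L1.IsPos.add {x y : L1 τ} (hx : L1.IsPos x) (hy : L1.IsPos y) : L1.IsPos (x + y) :=
  fun a ha => by simpa using add_nonneg (hx a ha) (hy a ha)

theorem L1.IsPos.smul {x : L1 τ} (hx : L1.IsPos x) {t : ℝ} (ht : 0 ≤ t) :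
    L1.IsPos ((t : ℂ) • x) :=
  fun a ha => by
    simpa using mul_nonneg (Complex.zero_le_real.2 ht) (hx a ha)

theorem L1.isPos_zero : L1.IsPos (0 : L1 τ) := fun a _ => by simp

theorem L1.isClosed_isPos : IsClosed {x : L1 τ | L1.IsPos x} := by
  simp only [L1.IsPos, Set.ofPred_forall]
  refine isClosed_iInter fun a => isClosed_iInter fun _ => ?_
  have h : Continuous fun x : L1 τ => (x : StrongDual ℂ M) a :=
    ((ContinuousLinearMap.apply ℂ ℂ a) ∘L (L1 τ).subtypeL).continuous
  exact isClosed_le continuous_const h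

theorem L1.continuous_sub_smul :
    Continuous fun p : ℝ × L1 τ × L1 τ => p.2.1 - (p.1 : ℂ) • p.2.2 := by
  have h : Continuous fun p : ℝ × L1 τ × L1 τ =>
      (p.2.1 : StrongDual ℂ M) - (p.1 : ℂ) • (p.2.2 : StrongDual ℂ M) := by fun_prop
  exact h.subtype_mk _

theorem L1.IsPos.trace_nonneg {x : L1 τ} (hx : L1.IsPos x) : 0 ≤ L1.trace x := hx 1 zero_le_one

theorem L1.IsPos.trace_eq_re {x : L1 τ} (hx : L1.IsPos x) :
    L1.trace x = ((L1.trace x).re : ℂ) :=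
  Complex.eq_re_of_ofReal_le hx.trace_nonneg

theorem L1.IsPos.re_trace_nonneg {x : L1 τ} (hx : L1.IsPos x) : 0 ≤ (L1.trace x).re :=
  (Complex.nonneg_iff.1 hx.trace_nonneg).1

/-- From 0 ≤ a ≤ ‖a‖·1, positivity squeezes the value at a between 0 and ‖a‖ τ(x) = 0, and positive
elements span `M`. -/
theorem L1.IsPos.eq_zero {x : L1 τ} (hx : L1.IsPos x) (h : L1.trace x = 0) : x = 0 := by
  have key : ∀ a : M, 0 ≤ a → (x : StrongDual ℂ M) a = 0 := by
    intro a ha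
    refine le_antisymm ?_ (hx a ha)
    have h1 : 0 ≤ algebraMap ℝ M ‖a‖ - a :=
      sub_nonneg.2 (IsSelfAdjoint.le_algebraMap_norm_self ha.isSelfAdjoint)
    have h2 := hx _ h1
    have h3 : (x : StrongDual ℂ M) (algebraMap ℝ M ‖a‖) = 0 := by
      rw [Algebra.algebraMap_eq_smul_one, ← Complex.coe_smul, map_smul]
      change _ • L1.trace x = 0
      rw [h, smul_zero]
    rw [map_sub, h3, zero_sub] at h2
    exact neg_nonneg.1 h2
  have h4 : ((x : StrongDual ℂ M) : M →ₗ[ℂ] ℂ) = 0 := by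
    refine LinearMap.ext_on CStarAlgebra.span_nonneg fun a ha => ?_
    simpa using key a ha
  ext a
  simpa using LinearMap.congr_fun h4 a

theorem L1.IsPos.re_trace_pos {x : L1 τ} (hx : L1.IsPos x) (h : x ≠ 0) :
    0 < (L1.trace x).re := by
  refine hx.re_trace_nonneg.lt_of_ne fun h0 => h (hx.eq_zero ?_)
  rw [hx.trace_eq_re, ← h0, Complex.ofReal_zero]

theorem ne_zero_of_mem_normalStates {x : L1 τ} (hx : x ∈ normalStates τ) : x ≠ 0 := by
  rintro rfl
  have := hx.2
  rw [← L1.traceCLM_apply, map_zero] at this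
  exact zero_ne_one this

end Cone

/-! ### The quantity m(x, y) and the Hennion metric -/

section MQuantity

variable {M : Type*} [CStarAlgebra M] [PartialOrder M] [StarOrderedRing M] {τ : M →ₚ[ℂ] ℂ}
  {x y : L1 τ}

theorem le_one_of_isPos_sub (hx : x ∈ normalStates τ) (hy : y ∈ normalStates τ) {t : ℝ}
    (h : L1.IsPos (x - (t : ℂ) • y)) : t ≤ 1 := by
  have := h.re_trace_nonneg
  rw [L1.trace_sub, L1.trace_smul, hx.2, hy.2] at this
  simpa using this

theorem le_mQuantity (hx : x ∈ normalStates τ) (hy : y ∈ normalStates τ) {t : ℝ}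
    (h : L1.IsPos (x - (t : ℂ) • y)) : t ≤ mQuantity x y :=
  le_csSup ⟨1, fun _ hs => le_one_of_isPos_sub hx hy hs⟩ h

/-- The supremum is attained: the cone is closed, 0 is admissible, and taking traces bounds
admissible values by 1. -/
theorem mQuantity_mem (hx : x ∈ normalStates τ) (hy : y ∈ normalStates τ) :
    L1.IsPos (x - ((mQuantity x y : ℝ) : ℂ) • y) := by
  have hc : IsClosed {t : ℝ | L1.IsPos (x - (t : ℂ) • y)} := by
    refine L1.isClosed_isPos.preimage (f := fun t : ℝ => x - (t : ℂ) • y) ?_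
    exact L1.continuous_sub_smul.comp (continuous_id.prodMk (continuous_const (y := (x, y))))
  refine hc.csSup_mem ⟨0, ?_⟩ ⟨1, fun _ hs => le_one_of_isPos_sub hx hy hs⟩
  rw [Set.mem_ofPred_eq, L1.sub_zero_smul]
  exact hx.1

theorem mQuantity_nonneg (hx : x ∈ normalStates τ) (hy : y ∈ normalStates τ) :
    0 ≤ mQuantity x y :=
  le_mQuantity hx hy (by rw [L1.sub_zero_smul]; exact hx.1)

theorem mQuantity_le_one (hx : x ∈ normalStates τ) (hy : y ∈ normalStates τ) :
    mQuantity x y ≤ 1 :=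
  le_one_of_isPos_sub hx hy (mQuantity_mem hx hy)

theorem mQuantity_self {x : L1 τ} (hx : x ∈ normalStates τ) : mQuantity x x = 1 :=
  le_antisymm (mQuantity_le_one hx hx) (le_mQuantity hx hx (by rw [L1.sub_one_smul_self]; exact L1.isPos_zero))

/-- Admissible values form a half-line because y is positive. In this form, superlevel sets of m
become membership in a closed cone. -/
theorem le_mQuantity_iff (hx : x ∈ normalStates τ) (hy : y ∈ normalStates τ) {t : ℝ} :
    t ≤ mQuantity x y ↔ L1.IsPos (x - (t : ℂ) • y) := by
  refine ⟨fun h => ?_, le_mQuantity hx hy⟩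
  have := (mQuantity_mem hx hy).add (hy.1.smul (sub_nonneg.2 h))
  convert this using 1
  push_cast
  module

theorem mQuantity_lt_one (hx : x ∈ normalStates τ) (hy : y ∈ normalStates τ) (h : x ≠ y) :
    mQuantity x y < 1 := by
  refine (mQuantity_le_one hx hy).lt_of_ne fun h1 => h ?_
  have h2 := mQuantity_mem hx hy
  rw [h1, Complex.ofReal_one, one_smul] at h2
  exact sub_eq_zero.1 (h2.eq_zero (by rw [L1.trace_sub, hx.2, hy.2, sub_self]))

theorem mul_mQuantity_nonneg (hx : x ∈ normalStates τ) (hy : y ∈ normalStates τ) :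
    0 ≤ mQuantity x y * mQuantity y x :=
  mul_nonneg (mQuantity_nonneg hx hy) (mQuantity_nonneg hy hx)

theorem mul_mQuantity_le_one (hx : x ∈ normalStates τ) (hy : y ∈ normalStates τ) :
    mQuantity x y * mQuantity y x ≤ 1 :=
  mul_le_one₀ (mQuantity_le_one hx hy) (mQuantity_nonneg hy hx) (mQuantity_le_one hy hx)

theorem hennionDist_nonneg (hx : x ∈ normalStates τ) (hy : y ∈ normalStates τ) :
    0 ≤ hennionDist x y := by
  have h1 := mul_mQuantity_nonneg hx hy
  have h2 := mul_mQuantity_le_one hx hy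
  exact div_nonneg (by linarith) (by linarith)

theorem hennionDist_le_one (hx : x ∈ normalStates τ) (hy : y ∈ normalStates τ) :
    hennionDist x y ≤ 1 := by
  have h1 := mul_mQuantity_nonneg hx hy
  exact div_le_one_of_le₀ (by linarith) (by linarith)

theorem hennionDist_self (hx : x ∈ normalStates τ) : hennionDist x x = 0 := by
  simp [hennionDist, mQuantity_self hx]

theorem hennionDist_pos (hx : x ∈ normalStates τ) (hy : y ∈ normalStates τ) (h : x ≠ y) :
    0 < hennionDist x y := by
  have h1 := mul_mQuantity_nonneg hx hy
  have h2 : mQuantity x y * mQuantity y x < 1 :=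
    mul_lt_one_of_nonneg_of_lt_one_left (mQuantity_nonneg hx hy) (mQuantity_lt_one hx hy h)
      (mQuantity_le_one hy hx)
  exact div_pos (by linarith) (by linarith)

end MQuantity

/-! ### Endpoints of the line through two states -/

section Extremal

variable {M : Type*} [CStarAlgebra M] [PartialOrder M] [StarOrderedRing M] {τ : M →ₚ[ℂ] ℂ}
  {x y : L1 τ}

/-- The endpoint beyond `x` of the intersection of the line through `x` and `y` with the
positive cone. -/
noncomputable def lineEnd (x y : L1 τ) : L1 τ :=
  (((1 - mQuantity x y)⁻¹ : ℝ) : ℂ) • (x - (mQuantity x y : ℂ) • y)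

theorem lineEnd_mem (hx : x ∈ normalStates τ) (hy : y ∈ normalStates τ) (h : x ≠ y) :
    lineEnd x y ∈ normalStates τ := by
  have h1 := mQuantity_lt_one hx hy h
  refine ⟨(mQuantity_mem hx hy).smul (inv_nonneg.2 (by linarith)), ?_⟩
  rw [lineEnd, L1.trace_smul, L1.trace_sub, L1.trace_smul, hx.2, hy.2, mul_one,
    ← Complex.ofReal_one, ← Complex.ofReal_sub, ← Complex.ofReal_mul,
    inv_mul_cancel₀ (by linarith)]

/-- If s > 0 were admissible for the endpoints, rewriting in terms of x and y would make (m + p)/(1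
+ p m') admissible for (x, y), with p = s(1 - m)/(1 - m'). This exceeds m because m m' < 1, against
maximality. -/
theorem mQuantity_lineEnd (hx : x ∈ normalStates τ) (hy : y ∈ normalStates τ) (h : x ≠ y) :
    mQuantity (lineEnd x y) (lineEnd y x) = 0 := by
  have hu := lineEnd_mem hx hy h
  have hv := lineEnd_mem hy hx h.symm
  have hm1 := mQuantity_lt_one hx hy h
  have hm2 := mQuantity_lt_one hy hx h.symm
  have hm0 := mQuantity_nonneg hx hy
  have hm0' := mQuantity_nonneg hy hx
  set m := mQuantity x y with hm
  set m' := mQuantity y x with hm'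
  refine le_antisymm ?_ (mQuantity_nonneg hu hv)
  by_contra! hs
  set s := mQuantity (lineEnd x y) (lineEnd y x) with hsdef
  have h1 := mQuantity_mem hu hv
  have h1m : 0 < 1 - m := by linarith
  have h1m' : 0 < 1 - m' := by linarith
  have hp : 0 < s * (1 - m) / (1 - m') := by positivity
  set p := s * (1 - m) / (1 - m') with hpdef
  have hp1 : 0 < 1 + p * m' := by positivity
  have h2 := h1.smul (t := (1 - m) / (1 + p * m')) (by positivity)
  have h3 : x - (((m + p) / (1 + p * m') : ℝ) : ℂ) • y =
      (((1 - m) / (1 + p * m') : ℝ) : ℂ) • (lineEnd x y - (s : ℂ) • lineEnd y x) := by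
    have e1 : (((1 - m) / (1 + p * m') : ℝ) : ℂ) • (lineEnd x y - (s : ℂ) • lineEnd y x) =
      (((1 + p * m')⁻¹ * ((1 - m) * (1 - m)⁻¹) : ℝ) : ℂ) • (x - (m : ℂ) • y) -
      (((1 + p * m')⁻¹ * p : ℝ) : ℂ) • (y - (m' : ℂ) • x) := by
      rw [hpdef, lineEnd, lineEnd, ← hm, ← hm']
      push_cast
      simp only [div_eq_mul_inv]
      module
    rw [e1, mul_inv_cancel₀ h1m.ne', mul_one]
    have e2 : ((1 + p * m')⁻¹ : ℝ) * (1 + p * m') = 1 := inv_mul_cancel₀ hp1.ne'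
    have e3 : x = (((1 + p * m')⁻¹ * (1 + p * m') : ℝ) : ℂ) • x := by
      rw [e2, Complex.ofReal_one, one_smul]
    nth_rewrite 1 [e3]
    simp only [div_eq_mul_inv]
    push_cast
    module
  rw [← h3] at h2
  have h4 := le_mQuantity hx hy h2
  rw [← hm, div_le_iff₀ hp1] at h4
  have h5 : m * m' < 1 := mul_lt_one_of_nonneg_of_lt_one_left hm0 hm1 hm2.le
  nlinarith

theorem lineEnd_ne (hx : x ∈ normalStates τ) (hy : y ∈ normalStates τ) (h : x ≠ y) :
    lineEnd x y ≠ lineEnd y x := by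
  intro he
  have h1 := mQuantity_lineEnd hx hy h
  rw [he, mQuantity_self (lineEnd_mem hy hx h.symm)] at h1
  exact one_ne_zero h1

theorem hennionDist_lineEnd (hx : x ∈ normalStates τ) (hy : y ∈ normalStates τ) (h : x ≠ y) :
    hennionDist (lineEnd x y) (lineEnd y x) = 1 := by
  simp [hennionDist, mQuantity_lineEnd hx hy h]

end Extremal

/-! ### The contraction constant as Lipschitz constant and as diameter -/

section Contraction

variable {M : Type*} [CStarAlgebra M] [PartialOrder M] [StarOrderedRing M] {τ : M →ₚ[ℂ] ℂ}
  {f g : L1 τ → L1 τ} {x y : L1 τ}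

theorem IsFaithfulPositive.re_trace_pos (hf : IsFaithfulPositive f) (hx : x ∈ normalStates τ) :
    0 < (L1.trace (f x)).re :=
  (hf.map_pos x hx.1).re_trace_pos fun h => ne_zero_of_mem_normalStates hx (hf.faithful x hx.1 h)

theorem IsFaithfulPositive.projAction_eq (hf : IsFaithfulPositive f) (hx : x ∈ normalStates τ) :
    projAction f x = (((L1.trace (f x)).re⁻¹ : ℝ) : ℂ) • f x := by
  rw [projAction, (hf.map_pos x hx.1).trace_eq_re, Complex.ofReal_inv, Complex.ofReal_re]

theorem IsFaithfulPositive.projAction_mem (hf : IsFaithfulPositive f)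
    (hx : x ∈ normalStates τ) : projAction f x ∈ normalStates τ := by
  have h0 := hf.re_trace_pos hx
  refine ⟨?_, ?_⟩
  · rw [hf.projAction_eq hx]
    exact (hf.map_pos x hx.1).smul (inv_nonneg.2 h0.le)
  · rw [hf.projAction_eq hx, L1.trace_smul, (hf.map_pos x hx.1).trace_eq_re,
      ← Complex.ofReal_mul, Complex.ofReal_re, inv_mul_cancel₀ h0.ne', Complex.ofReal_one]

theorem IsFaithfulPositive.comp (hf : IsFaithfulPositive f) (hg : IsFaithfulPositive g) :
    IsFaithfulPositive (f ∘ g) where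
  isLinearMap := ⟨fun x y => by simp [hf.1.map_add, hg.1.map_add],
    fun c x => by simp [hf.1.map_smul, hg.1.map_smul]⟩
  map_pos x hx := hf.map_pos _ (hg.map_pos x hx)
  faithful x hx h := hg.faithful x hx (hf.faithful _ (hg.map_pos x hx) h)

theorem IsFaithfulPositive.projAction_comp (hf : IsFaithfulPositive f)
    (hg : IsFaithfulPositive g) (hx : x ∈ normalStates τ) :
    projAction (f ∘ g) x = projAction f (projAction g x) := by
  have h0 : L1.trace (g x) ≠ 0 := fun h => (hg.re_trace_pos hx).ne' (by rw [h, Complex.zero_re])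
  simp only [projAction, Function.comp, hf.1.map_smul, L1.trace_smul, smul_smul]
  rw [mul_inv, inv_inv, mul_right_comm, mul_inv_cancel₀ h0, one_mul]

theorem IsFaithfulPositive.le_mQuantity_projAction (hf : IsFaithfulPositive f)
    (hx : x ∈ normalStates τ) (hy : y ∈ normalStates τ) {p q : ℝ} (hp : 0 < p)
    (h : L1.IsPos ((p : ℂ) • f x - (q : ℂ) • f y)) :
    q / p * ((L1.trace (f y)).re / (L1.trace (f x)).re) ≤
      mQuantity (projAction f x) (projAction f y) := by
  have hx0 := hf.re_trace_pos hx
  have hy0 := hf.re_trace_pos hy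
  refine le_mQuantity (hf.projAction_mem hx) (hf.projAction_mem hy) ?_
  rw [hf.projAction_eq hx, hf.projAction_eq hy]
  set a := (L1.trace (f x)).re
  set b := (L1.trace (f y)).re
  have h1 := h.smul (t := (p * a)⁻¹) (by positivity)
  convert h1 using 1
  have e1 : ((p * a)⁻¹ * p : ℝ) = a⁻¹ := by field_simp
  have e2 : ((p * a)⁻¹ * q : ℝ) = q / p * (b / a) * b⁻¹ := by field_simp
  rw [L1.smul_sub_smul, smul_smul, ← Complex.ofReal_mul, ← Complex.ofReal_mul,
    ← Complex.ofReal_mul, e1, e2]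

theorem IsFaithfulPositive.isPos_sub_smul (hf : IsFaithfulPositive f)
    (hx : x ∈ normalStates τ) (hy : y ∈ normalStates τ) :
    L1.IsPos (f x - ((mQuantity (projAction f x) (projAction f y) *
      ((L1.trace (f x)).re / (L1.trace (f y)).re) : ℝ) : ℂ) • f y) := by
  have hx0 := hf.re_trace_pos hx
  have hy0 := hf.re_trace_pos hy
  have h := (mQuantity_mem (hf.projAction_mem hx) (hf.projAction_mem hy)).smul hx0.le
  set s := mQuantity (projAction f x) (projAction f y)
  rw [hf.projAction_eq hx, hf.projAction_eq hy] at h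
  set a := (L1.trace (f x)).re
  set b := (L1.trace (f y)).re
  convert h using 1
  rw [smul_smul, L1.smul_sub_smul, ← Complex.ofReal_mul, ← Complex.ofReal_mul,
    ← Complex.ofReal_mul, mul_inv_cancel₀ hx0.ne', Complex.ofReal_one, one_smul]
  congr 3
  ring

/-- A lower bound for `m` on images in terms of the endpoints of the line through `x` and `y`. -/
theorem IsFaithfulPositive.le_mQuantity_of_lineEnd (hf : IsFaithfulPositive f)
    (hx : x ∈ normalStates τ) (hy : y ∈ normalStates τ) (h : x ≠ y) :
    let p := mQuantity (projAction f (lineEnd x y)) (projAction f (lineEnd y x)) *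
      ((L1.trace (f (lineEnd x y))).re / (L1.trace (f (lineEnd y x))).re) *
      ((1 - mQuantity x y) / (1 - mQuantity y x))
    (mQuantity x y + p) / (1 + p * mQuantity y x) *
      ((L1.trace (f y)).re / (L1.trace (f x)).re) ≤
      mQuantity (projAction f x) (projAction f y) := by
  intro p
  have hu := lineEnd_mem hx hy h
  have hv := lineEnd_mem hy hx h.symm
  have hm1 := mQuantity_lt_one hx hy h
  have hm2 := mQuantity_lt_one hy hx h.symm
  have hm0 := mQuantity_nonneg hx hy
  have hm0' := mQuantity_nonneg hy hx
  have hs0 := mQuantity_nonneg (hf.projAction_mem hu) (hf.projAction_mem hv)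
  have hα := hf.re_trace_pos hu
  have hβ := hf.re_trace_pos hv
  have h1 := hf.isPos_sub_smul hu hv
  have hpdef : p = mQuantity (projAction f (lineEnd x y)) (projAction f (lineEnd y x)) *
      ((L1.trace (f (lineEnd x y))).re / (L1.trace (f (lineEnd y x))).re) *
      ((1 - mQuantity x y) / (1 - mQuantity y x)) := rfl
  clear_value p
  set S := mQuantity (projAction f (lineEnd x y)) (projAction f (lineEnd y x)) *
      ((L1.trace (f (lineEnd x y))).re / (L1.trace (f (lineEnd y x))).re) with hS
  have hS0 : 0 ≤ S := by positivity
  clear_value S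
  have hfl : ∀ a b : L1 τ, f (lineEnd a b) =
      (((1 - mQuantity a b)⁻¹ : ℝ) : ℂ) • (f a - (mQuantity a b : ℂ) • f b) := by
    intro a b
    rw [lineEnd, hf.1.map_smul, L1.map_sub_smul hf.1]
  rw [hfl, hfl] at h1
  set m := mQuantity x y with hm
  set m' := mQuantity y x with hm'
  have h1m : 0 < 1 - m := by linarith
  have h1m' : 0 < 1 - m' := by linarith
  have hp : 0 ≤ p := by rw [hpdef]; positivity
  refine hf.le_mQuantity_projAction hx hy (by positivity) ?_
  have h2 := h1.smul h1m.le
  have e : ∀ a b : L1 τ, ((1 - m : ℝ) : ℂ) • ((((1 - m)⁻¹ : ℝ) : ℂ) • (a - (m : ℂ) • b) -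
      (S : ℂ) • ((((1 - m')⁻¹ : ℝ) : ℂ) • (b - (m' : ℂ) • a))) =
      ((1 + p * m' : ℝ) : ℂ) • a - ((m + p : ℝ) : ℂ) • b := by
    intro a b
    have e1 : ((1 - m : ℝ) : ℂ) • ((((1 - m)⁻¹ : ℝ) : ℂ) • (a - (m : ℂ) • b) -
      (S : ℂ) • ((((1 - m')⁻¹ : ℝ) : ℂ) • (b - (m' : ℂ) • a))) =
      (((1 - m) * (1 - m)⁻¹ : ℝ) : ℂ) • (a - (m : ℂ) • b) -
      ((S * ((1 - m) / (1 - m')) : ℝ) : ℂ) • (b - (m' : ℂ) • a) := by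
      simp only [div_eq_mul_inv]
      push_cast
      module
    rw [e1, ← hpdef, mul_inv_cancel₀ h1m.ne']
    push_cast
    module
  rwa [e] at h2

/-- Contraction of the Hennion metric under the projective action. -/
theorem IsFaithfulPositive.hennionDist_projAction_le_mul (hf : IsFaithfulPositive f)
    (hx : x ∈ normalStates τ) (hy : y ∈ normalStates τ) (h : x ≠ y) :
    hennionDist (projAction f x) (projAction f y) ≤
      hennionDist (projAction f (lineEnd x y)) (projAction f (lineEnd y x)) *
        hennionDist x y := by
  have hu := lineEnd_mem hx hy h
  have hv := lineEnd_mem hy hx h.symm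
  have hm1 := mQuantity_lt_one hx hy h
  have hm2 := mQuantity_lt_one hy hx h.symm
  have hm0 := mQuantity_nonneg hx hy
  have hm0' := mQuantity_nonneg hy hx
  have hs0 := mQuantity_nonneg (hf.projAction_mem hu) (hf.projAction_mem hv)
  have hs0' := mQuantity_nonneg (hf.projAction_mem hv) (hf.projAction_mem hu)
  have hα := hf.re_trace_pos hu
  have hβ := hf.re_trace_pos hv
  have ha := hf.re_trace_pos hx
  have hb := hf.re_trace_pos hy
  have h1 := hf.le_mQuantity_of_lineEnd hx hy h
  have h2 := hf.le_mQuantity_of_lineEnd hy hx h.symm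
  have hW0 := mQuantity_nonneg (hf.projAction_mem hx) (hf.projAction_mem hy)
  have hW0' := mQuantity_nonneg (hf.projAction_mem hy) (hf.projAction_mem hx)
  have hr1 := mul_mQuantity_le_one (hf.projAction_mem hu) (hf.projAction_mem hv)
  have ht1 := mul_mQuantity_le_one hx hy
  simp only [hennionDist]
  set m := mQuantity x y
  set m' := mQuantity y x
  set s := mQuantity (projAction f (lineEnd x y)) (projAction f (lineEnd y x))
  set s' := mQuantity (projAction f (lineEnd y x)) (projAction f (lineEnd x y))
  set W := mQuantity (projAction f x) (projAction f y)
  set W' := mQuantity (projAction f y) (projAction f x)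
  set α := (L1.trace (f (lineEnd x y))).re
  set β := (L1.trace (f (lineEnd y x))).re
  set a := (L1.trace (f x)).re
  set b := (L1.trace (f y)).re
  simp only at h1 h2
  have h1m : 0 < 1 - m := by linarith
  have h1m' : 0 < 1 - m' := by linarith
  set p := s * (α / β) * ((1 - m) / (1 - m')) with hp
  set q := s' * (β / α) * ((1 - m') / (1 - m)) with hq
  -- The normalizing factors of the two bounds are reciprocal, so only the projective quantity
  -- survives in the product.
  have hpq : p * q = s * s' := by rw [hp, hq]; field_simp
  have hp0 : 0 ≤ p := by positivity
  have hq0 : 0 ≤ q := by positivity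
  clear_value p q
  rw [← hpq] at hr1 ⊢
  have hR : (m + p) / (1 + p * m') * ((m' + q) / (1 + q * m)) ≤ W * W' := by
    have h3 := mul_le_mul h1 h2 (by positivity) hW0
    refine le_trans (le_of_eq ?_) h3
    field_simp
  have hWW : 0 ≤ W * W' := by positivity
  rw [div_mul_div_comm, div_le_iff₀ (by positivity)] at hR
  rw [div_mul_div_comm, div_le_div_iff₀ (by positivity) (by positivity)]
  have hw0 : 0 ≤ m * q + p * m' := by positivity
  -- With t = m m' and r = p q, the goal says V ≥ (t + r)/(1 + r t), the addition law of tanh. The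
  -- cross term w = m q + p m' is added to both numerator and denominator and can be dropped when V
  -- ≤ 1; when V > 1 the left side of the goal is negative.
  have hR' : (m * m' + p * q) + (m * q + p * m') ≤
      W * W' * (1 + (p * q) * (m * m') + (m * q + p * m')) := by
    nlinarith
  have ht0 : 0 ≤ m * m' := by positivity
  have hr0 : 0 ≤ p * q := by positivity
  generalize m * m' = t at *
  generalize p * q = r at *
  generalize m * q + p * m' = w at *
  generalize W * W' = V at *
  have : 0 ≤ (1 - t) * (1 - r) := mul_nonneg (by linarith) (by linarith)
  by_cases hV : V ≤ 1
  · nlinarith [mul_nonneg hw0 (sub_nonneg.2 hV)]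
  · push Not at hV
    have : (1 - V) * ((1 + r) * (1 + t)) ≤ 0 :=
      mul_nonpos_of_nonpos_of_nonneg (by linarith) (by positivity)
    have : 0 ≤ (1 - r) * (1 - t) * (1 + V) :=
      mul_nonneg (by linarith) (by linarith)
    linarith

/-- Each Lipschitz ratio is dominated by a distance between two image points, so the Lipschitz
constant is at most the diameter of the image. It also shows that the ratios are bounded, so that
their supremum is meaningful. -/
theorem IsFaithfulPositive.ratio_le (hf : IsFaithfulPositive f)
    (hx : x ∈ normalStates τ) (hy : y ∈ normalStates τ) (h : x ≠ y) :
    hennionDist (projAction f x) (projAction f y) / hennionDist x y ≤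
      hennionDist (projAction f (lineEnd x y)) (projAction f (lineEnd y x)) := by
  rw [div_le_iff₀ (hennionDist_pos hx hy h)]
  exact hf.hennionDist_projAction_le_mul hx hy h

theorem IsFaithfulPositive.ratio_le_contractionConst (hf : IsFaithfulPositive f)
    (hx : x ∈ normalStates τ) (hy : y ∈ normalStates τ) (h : x ≠ y) :
    hennionDist (projAction f x) (projAction f y) / hennionDist x y ≤ contractionConst f := by
  rw [contractionConst, if_pos hf]
  refine le_csSup ⟨1, ?_⟩ ⟨x, hx, y, hy, h, rfl⟩
  rintro _ ⟨u, hu, v, hv, huv, rfl⟩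
  exact (hf.ratio_le hu hv huv).trans (hennionDist_le_one
    (hf.projAction_mem (lineEnd_mem hu hv huv)) (hf.projAction_mem (lineEnd_mem hv hu huv.symm)))

/-- The contraction constant is at most the diameter of the image of the state space. -/
theorem IsFaithfulPositive.contractionConst_le (hf : IsFaithfulPositive f) {t : ℝ} (ht : 0 ≤ t)
    (h : ∀ x ∈ normalStates τ, ∀ y ∈ normalStates τ,
      hennionDist (projAction f x) (projAction f y) ≤ t) : contractionConst f ≤ t := by
  rw [contractionConst, if_pos hf]
  refine Real.sSup_le ?_ ht
  rintro _ ⟨u, hu, v, hv, huv, rfl⟩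
  exact (hf.ratio_le hu hv huv).trans (h _ (lineEnd_mem hu hv huv) _ (lineEnd_mem hv hu huv.symm))

theorem contractionConst_nonneg (f : L1 τ → L1 τ) : 0 ≤ contractionConst f := by
  rw [contractionConst]
  split_ifs with hf
  · refine Real.sSup_nonneg ?_
    rintro _ ⟨u, hu, v, hv, -, rfl⟩
    exact div_nonneg (hennionDist_nonneg (hf.projAction_mem hu) (hf.projAction_mem hv))
      (hennionDist_nonneg hu hv)
  · exact zero_le_one

theorem contractionConst_le_one (f : L1 τ → L1 τ) : contractionConst f ≤ 1 := by
  by_cases hf : IsFaithfulPositive f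
  · exact hf.contractionConst_le zero_le_one fun x hx y hy =>
      hennionDist_le_one (hf.projAction_mem hx) (hf.projAction_mem hy)
  · rw [contractionConst, if_neg hf]

/-- The contraction constant is at least the diameter of the image of the state space. -/
theorem IsFaithfulPositive.hennionDist_projAction_le (hf : IsFaithfulPositive f)
    (hx : x ∈ normalStates τ) (hy : y ∈ normalStates τ) :
    hennionDist (projAction f x) (projAction f y) ≤ contractionConst f := by
  by_cases h : x = y
  · rw [h, hennionDist_self (hf.projAction_mem hy)]
    exact contractionConst_nonneg f
  -- The endpoints are at distance 1, so their ratio is itself the distance of their images.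
  · have h1 := hf.ratio_le_contractionConst (lineEnd_mem hx hy h) (lineEnd_mem hy hx (Ne.symm h))
      (lineEnd_ne hx hy h)
    rw [hennionDist_lineEnd hx hy h, div_one] at h1
    refine le_trans (hf.hennionDist_projAction_le_mul hx hy h) (le_trans ?_ h1)
    exact mul_le_of_le_one_right (hennionDist_nonneg (hf.projAction_mem (lineEnd_mem hx hy h))
      (hf.projAction_mem (lineEnd_mem hy hx (Ne.symm h)))) (hennionDist_le_one hx hy)

theorem IsFaithfulPositive.hennionDist_projAction_le_contractionConst_mul
    (hf : IsFaithfulPositive f) (hx : x ∈ normalStates τ) (hy : y ∈ normalStates τ) :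
    hennionDist (projAction f x) (projAction f y) ≤ contractionConst f * hennionDist x y := by
  by_cases h : x = y
  · rw [h, hennionDist_self (hf.projAction_mem hy), hennionDist_self hy, mul_zero]
  · rw [← div_le_iff₀ (hennionDist_pos hx hy h)]
    exact hf.ratio_le_contractionConst hx hy h

/-- The diameter of the image of f ∘ g is at most the Lipschitz constant of f times the diameter of
the image of g; both are values of c. -/
theorem IsFaithfulPositive.contractionConst_comp_le (hf : IsFaithfulPositive f)
    (hg : IsFaithfulPositive g) :
    contractionConst (f ∘ g) ≤ contractionConst f * contractionConst g := by
  refine (hf.comp hg).contractionConst_le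
    (mul_nonneg (contractionConst_nonneg f) (contractionConst_nonneg g)) fun x hx y hy => ?_
  rw [hf.projAction_comp hg hx, hf.projAction_comp hg hy]
  refine (hf.hennionDist_projAction_le_contractionConst_mul (hg.projAction_mem hx)
    (hg.projAction_mem hy)).trans ?_
  exact mul_le_mul_of_nonneg_left (hg.hennionDist_projAction_le hx hy) (contractionConst_nonneg f)

/-- The default value 1 excludes maps that are not faithful positive, so strict contraction is an
event in the σ-algebra of the constants. -/
theorem isSHC_iff : IsSHC f ↔ contractionConst f < 1 := by
  refine ⟨fun h => h.2, fun h => ⟨?_, h⟩⟩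
  by_contra hf
  rw [contractionConst, if_neg hf] at h
  exact lt_irrefl _ h

end Contraction

/-! ### Evaluating a random continuous map at a random point -/

section Apply

/-- The Carathéodory argument: for a simple Y, glue over its finitely many fibres; in general,
approximate Y by simple functions and use continuity. -/
theorem aestronglyMeasurable_apply_of_continuous {Ω E F : Type*} [MeasurableSpace Ω]
    {P : Measure Ω} [TopologicalSpace E] [TopologicalSpace F]
    [TopologicalSpace.PseudoMetrizableSpace F] {u : Ω → E → F}
    (hu : ∀ x, AEStronglyMeasurable (fun ω => u ω x) P) (hc : ∀ᵐ ω ∂P, Continuous (u ω))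
    {Y : Ω → E} (hY : AEStronglyMeasurable Y P) :
    AEStronglyMeasurable (fun ω => u ω (Y ω)) P := by
  have hs : ∀ s : SimpleFunc Ω E, AEStronglyMeasurable (fun ω => u ω (s ω)) P := by
    intro s
    have h1 : (⋃ v : s.range, s ⁻¹' {(v : E)}) = Set.univ := by
      ext ω
      simp
    rw [← Measure.restrict_univ (μ := P), ← h1, aestronglyMeasurable_iUnion_iff]
    intro v
    refine (hu v).restrict.congr ?_
    filter_upwards [ae_restrict_mem (s.measurableSet_fiber v)] with ω hω
    rw [show s ω = v from hω]
  obtain ⟨Y', hY', hYY'⟩ := hY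
  refine aestronglyMeasurable_of_tendsto_ae atTop (fun n => hs (hY'.approx n)) ?_
  filter_upwards [hYY', hc] with ω h1 h2
  rw [h1]
  exact (h2.tendsto _).comp (hY'.tendsto_approx ω)

end Apply

/-! ### Measurability of the contraction constant -/

section Measurability

variable {M : Type*} [CStarAlgebra M] [PartialOrder M] [StarOrderedRing M] {τ : M →ₚ[ℂ] ℂ}
variable {Ω : Type*} [MeasurableSpace Ω] {P : Measure Ω}

theorem aemeasurable_mQuantity {X Y : Ω → L1 τ} (hX : AEStronglyMeasurable X P)
    (hY : AEStronglyMeasurable Y P) (hXS : ∀ᵐ ω ∂P, X ω ∈ normalStates τ)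
    (hYS : ∀ᵐ ω ∂P, Y ω ∈ normalStates τ) :
    AEMeasurable (fun ω => mQuantity (X ω) (Y ω)) P := by
  refine NullMeasurable.aemeasurable ?_
  refine @measurable_of_Ici ℝ (NullMeasurableSpace Ω P) _ _ _ _ _ _ _ _ fun t => ?_
  have hZ : AEStronglyMeasurable (fun ω => X ω - (t : ℂ) • Y ω) P :=
    (L1.continuous_sub_smul.comp (continuous_const.prodMk continuous_id)
      : Continuous fun p : L1 τ × L1 τ => p.1 - (t : ℂ) • p.2).comp_aestronglyMeasurable
      (hX.prodMk hY)
  let _ : MeasurableSpace (L1 τ) := borel _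
  have _ : BorelSpace (L1 τ) := ⟨rfl⟩
  have h1 : NullMeasurableSet ((fun ω => X ω - (t : ℂ) • Y ω) ⁻¹' {z | L1.IsPos z}) P :=
    hZ.aemeasurable.nullMeasurable (L1.isClosed_isPos.measurableSet)
  refine NullMeasurableSet.congr h1 ?_
  filter_upwards [hXS, hYS] with ω hx hy
  exact propext (le_mQuantity_iff hx hy).symm

theorem aemeasurable_hennionDist {X Y : Ω → L1 τ} (hX : AEStronglyMeasurable X P)
    (hY : AEStronglyMeasurable Y P) (hXS : ∀ᵐ ω ∂P, X ω ∈ normalStates τ)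
    (hYS : ∀ᵐ ω ∂P, Y ω ∈ normalStates τ) :
    AEMeasurable (fun ω => hennionDist (X ω) (Y ω)) P := by
  have h := (aemeasurable_mQuantity hX hY hXS hYS).mul (aemeasurable_mQuantity hY hX hYS hXS)
  exact (h.const_sub 1).div (h.const_add 1)

theorem IsFaithfulPositive.continuous {f : L1 τ → L1 τ} (hf : IsFaithfulPositive f)
    (hb : ∃ K : ℝ, ∀ x, ‖f x‖ ≤ K * ‖x‖) : Continuous f := by
  obtain ⟨K, hK⟩ := hb
  exact (LinearMap.mkContinuous (hf.isLinearMap.mk' f) K hK).continuous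

theorem IsFaithfulPositive.tendsto_projAction {f : L1 τ → L1 τ} (hf : IsFaithfulPositive f)
    (hc : Continuous f) {u : ℕ → L1 τ} {x : L1 τ} (hx : x ∈ normalStates τ)
    (hu : Tendsto u atTop (𝓝 x)) :
    Tendsto (fun n => projAction f (u n)) atTop (𝓝 (projAction f x)) := by
  have h0 : L1.trace (f x) ≠ 0 := fun h => (hf.re_trace_pos hx).ne' (by rw [h, Complex.zero_re])
  have h1 : Tendsto (fun n => f (u n)) atTop (𝓝 (f x)) := (hc.tendsto x).comp hu
  exact (((L1.continuous_trace.tendsto _).comp h1).inv₀ h0).smul h1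

theorem hennionDist_le_iff {x y : L1 τ} (hx : x ∈ normalStates τ) (hy : y ∈ normalStates τ)
    {t : ℝ} (ht : 0 ≤ t) :
    hennionDist x y ≤ t ↔ (1 - t) / (1 + t) ≤ mQuantity x y * mQuantity y x := by
  have h1 := mul_mQuantity_nonneg hx hy
  rw [hennionDist, div_le_iff₀ (by linarith), div_le_iff₀ (by linarith)]
  constructor <;> intro h <;> linarith

/-- Lower semicontinuity of the Hennion metric. -/
theorem hennionDist_le_of_tendsto {u v : ℕ → L1 τ} {x y : L1 τ}
    (hu : ∀ n, u n ∈ normalStates τ) (hv : ∀ n, v n ∈ normalStates τ)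
    (hx : x ∈ normalStates τ) (hy : y ∈ normalStates τ)
    (hux : Tendsto u atTop (𝓝 x)) (hvy : Tendsto v atTop (𝓝 y)) {t : ℝ} (ht : 0 ≤ t)
    (h : ∀ n, hennionDist (u n) (v n) ≤ t) : hennionDist x y ≤ t := by
  -- Both m-values lie in [0, 1], so they converge along a subsequence. Since the cone is closed,
  -- the limits are admissible for (x, y), hence at most m(x, y) and m(y, x).
  have hK : IsCompact (Set.Icc (0 : ℝ) 1 ×ˢ Set.Icc (0 : ℝ) 1) := isCompact_Icc.prod isCompact_Icc
  obtain ⟨⟨α, β⟩, -, φ, hφ, hlim⟩ := hK.tendsto_subseq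
    (x := fun n => (mQuantity (u n) (v n), mQuantity (v n) (u n))) fun n =>
      ⟨⟨mQuantity_nonneg (hu n) (hv n), mQuantity_le_one (hu n) (hv n)⟩,
        ⟨mQuantity_nonneg (hv n) (hu n), mQuantity_le_one (hv n) (hu n)⟩⟩
  have hα : Tendsto (fun n => mQuantity (u (φ n)) (v (φ n))) atTop (𝓝 α) :=
    (continuous_fst.tendsto _).comp hlim
  have hβ : Tendsto (fun n => mQuantity (v (φ n)) (u (φ n))) atTop (𝓝 β) :=
    (continuous_snd.tendsto _).comp hlim
  have hux' := hux.comp hφ.tendsto_atTop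
  have hvy' := hvy.comp hφ.tendsto_atTop
  have h1 : α ≤ mQuantity x y := le_mQuantity hx hy <| L1.isClosed_isPos.mem_of_tendsto
    ((L1.continuous_sub_smul.tendsto (α, x, y)).comp (hα.prodMk_nhds (hux'.prodMk_nhds hvy')))
    (Eventually.of_forall fun n => mQuantity_mem (hu _) (hv _))
  have h2 : β ≤ mQuantity y x := le_mQuantity hy hx <| L1.isClosed_isPos.mem_of_tendsto
    ((L1.continuous_sub_smul.tendsto (β, y, x)).comp (hβ.prodMk_nhds (hvy'.prodMk_nhds hux')))
    (Eventually.of_forall fun n => mQuantity_mem (hv _) (hu _))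
  have hβ0 : 0 ≤ β := ge_of_tendsto' hβ fun n => mQuantity_nonneg (hv _) (hu _)
  rw [hennionDist_le_iff hx hy ht]
  refine le_trans (ge_of_tendsto' (hα.mul hβ) fun n =>
    (hennionDist_le_iff (hu _) (hv _) ht).1 (h _)) ?_
  exact mul_le_mul h1 h2 hβ0 (mQuantity_nonneg hx hy)

theorem IsFaithfulPositive.contractionConst_le_of_dense {f : L1 τ → L1 τ}
    (hf : IsFaithfulPositive f) (hc : Continuous f) {D : Set (L1 τ)} (hD : D ⊆ normalStates τ)
    (hDS : normalStates τ ⊆ closure D) {t : ℝ} (ht : 0 ≤ t)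
    (h : ∀ x ∈ D, ∀ y ∈ D, hennionDist (projAction f x) (projAction f y) ≤ t) :
    contractionConst f ≤ t := by
  refine hf.contractionConst_le ht fun x hx y hy => ?_
  obtain ⟨u, huD, hux⟩ := mem_closure_iff_seq_limit.1 (hDS hx)
  obtain ⟨v, hvD, hvy⟩ := mem_closure_iff_seq_limit.1 (hDS hy)
  exact hennionDist_le_of_tendsto (fun n => hf.projAction_mem (hD (huD n)))
    (fun n => hf.projAction_mem (hD (hvD n))) (hf.projAction_mem hx) (hf.projAction_mem hy)
    (hf.tendsto_projAction hc hx hux) (hf.tendsto_projAction hc hy hvy) ht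
    fun n => h _ (huD n) _ (hvD n)

variable {F G : Ω → L1 τ → L1 τ}

theorem IsRandomOperator.continuous (hF : IsRandomOperator P F) : ∀ᵐ ω ∂P, Continuous (F ω) := by
  filter_upwards [hF.faithfulPositive, hF.bounded] with ω h1 h2 using h1.continuous h2

theorem IsRandomOperator.comp (hF : IsRandomOperator P F) (hG : IsRandomOperator P G) :
    IsRandomOperator P fun ω => F ω ∘ G ω where
  measurable x := aestronglyMeasurable_apply_of_continuous hF.measurable hF.continuous
    (hG.measurable x)
  faithfulPositive := by
    filter_upwards [hF.faithfulPositive, hG.faithfulPositive] with ω h1 h2 using h1.comp h2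
  bounded := by
    filter_upwards [hF.bounded, hG.bounded] with ω ⟨K, hK⟩ ⟨L, hL⟩
    refine ⟨|K| * L, fun x => (hK (G ω x)).trans ?_⟩
    rw [mul_assoc]
    exact mul_le_mul (le_abs_self K) (hL x) (norm_nonneg (G ω x : StrongDual ℂ M)) (abs_nonneg K)

theorem IsRandomOperator.comp_measurePreserving (hF : IsRandomOperator P F) {S : Ω → Ω}
    (hS : MeasurePreserving S P P) : IsRandomOperator P fun ω => F (S ω) where
  measurable x := (hF.measurable x).comp_quasiMeasurePreserving hS.quasiMeasurePreserving
  faithfulPositive := hS.quasiMeasurePreserving.ae hF.faithfulPositive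
  bounded := hS.quasiMeasurePreserving.ae hF.bounded

theorem IsRandomOperator.aestronglyMeasurable_projAction (hF : IsRandomOperator P F) (x : L1 τ) :
    AEStronglyMeasurable (fun ω => projAction (F ω) x) P :=
  (L1.continuous_trace.comp_aestronglyMeasurable
    (hF.measurable x)).aemeasurable.inv.aestronglyMeasurable.smul (hF.measurable x)

/-- By the diameter formula and lower semicontinuity of d, the constant is almost surely a supremum
over countably many pairs of states. -/
theorem IsRandomOperator.aemeasurable_contractionConst
    [TopologicalSpace.SeparableSpace (L1 τ)] (hF : IsRandomOperator P F) :
    AEMeasurable (fun ω => contractionConst (F ω)) P := by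
  obtain ⟨D, hD, hDc, hDS⟩ := (TopologicalSpace.IsSeparable.of_separableSpace
    (normalStates τ)).exists_countable_dense_subset
  have _ : Countable D := hDc
  have hmem : ∀ x : D, ∀ᵐ ω ∂P, projAction (F ω) x ∈ normalStates τ := fun x => by
    filter_upwards [hF.faithfulPositive] with ω h using h.projAction_mem (hD x.2)
  have h1 : AEMeasurable (fun ω => ⨆ p : D × D,
      hennionDist (projAction (F ω) p.1) (projAction (F ω) p.2)) P :=
    AEMeasurable.iSup fun p => aemeasurable_hennionDist
      (hF.aestronglyMeasurable_projAction p.1) (hF.aestronglyMeasurable_projAction p.2)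
      (hmem p.1) (hmem p.2)
  refine h1.congr ?_
  filter_upwards [hF.faithfulPositive, hF.continuous] with ω h2 h3
  have hle : ∀ p : D × D, hennionDist (projAction (F ω) p.1) (projAction (F ω) p.2) ≤
      contractionConst (F ω) := fun p => h2.hennionDist_projAction_le (hD p.1.2) (hD p.2.2)
  refine le_antisymm (Real.iSup_le hle (contractionConst_nonneg _)) ?_
  refine h2.contractionConst_le_of_dense h3 hD hDS (Real.iSup_nonneg fun p =>
    hennionDist_nonneg (h2.projAction_mem (hD p.1.2)) (h2.projAction_mem (hD p.2.2)))
    fun x hx y hy => ?_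
  exact le_ciSup (f := fun p : D × D =>
    hennionDist (projAction (F ω) p.1) (projAction (F ω) p.2))
    ⟨contractionConst (F ω), by rintro _ ⟨p, rfl⟩; exact hle p⟩ (⟨x, hx⟩, ⟨y, hy⟩)

end Measurability

/-! ### The subadditive ergodic theorem -/

section Subadditive

variable {Ω : Type*} {S : Ω → Ω} {g : ℕ → Ω → ℝ}

/-- Greedy covering of an orbit by blocks on which the subadditive process grows at rate less
than `b`. -/
theorem le_of_greedy_cover {A : Set Ω} {b : ℝ} {N : ℕ} (hb : b ≤ 0)
    (hA : ∀ x ∈ A, ∃ l, 1 ≤ l ∧ l ≤ N ∧ g l x ≤ b * l) {x : Ω}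
    (hg0 : ∀ n k, g n (S^[k] x) ≤ 0)
    (hsub : ∀ m n k, g (m + n) (S^[k] x) ≤ g m (S^[k] x) + g n (S^[m + k] x)) (n k : ℕ) :
    g n (S^[k] x) ≤ b * (∑ j ∈ Finset.range n, A.indicator 1 (S^[j + k] x) - N) := by
  have hind : ∀ y : Ω, A.indicator (1 : Ω → ℝ) y ≤ 1 := fun y =>
    Set.indicator_le_self' (fun _ _ => zero_le_one) y
  have hsum : ∀ m k : ℕ, ∑ j ∈ Finset.range m, A.indicator (1 : Ω → ℝ) (S^[j + k] x) ≤ m := by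
    intro m k
    simpa using Finset.sum_le_card_nsmul (Finset.range m)
      (fun j => A.indicator (1 : Ω → ℝ) (S^[j + k] x)) 1 fun j _ => hind _
  have hsplit : ∀ l m k : ℕ, ∑ j ∈ Finset.range (l + m), A.indicator (1 : Ω → ℝ) (S^[j + k] x) =
      ∑ j ∈ Finset.range l, A.indicator (1 : Ω → ℝ) (S^[j + k] x) +
      ∑ j ∈ Finset.range m, A.indicator (1 : Ω → ℝ) (S^[j + (l + k)] x) := by
    intro l m k
    rw [Finset.sum_range_add]
    congr 1
    refine Finset.sum_congr rfl fun j _ => ?_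
    rw [show l + j + k = j + (l + k) by ring]
  induction n using Nat.strong_induction_on generalizing k with
  | _ n ih =>
    -- The term -N in the bound pays for a final stretch of length at most N, on which the right
    -- side is nonnegative.
    by_cases hn : n ≤ N
    · refine (hg0 n k).trans (mul_nonneg_of_nonpos_of_nonpos hb ?_)
      have := hsum n k
      have : (n : ℝ) ≤ N := by exact_mod_cast hn
      linarith
    push Not at hn
    -- On a visit to A, jump over a whole block of length l; it has at most l visits, and b ≤ 0.
    -- Otherwise advance one step, which costs nothing and counts no visit.
    by_cases hx : S^[k] x ∈ A
    · obtain ⟨l, hl1, hlN, hl⟩ := hA _ hx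
      obtain ⟨m, rfl⟩ : ∃ m, n = l + m := ⟨n - l, by omega⟩
      have h1 := ih m (by omega) (l + k)
      have h2 := hsub l m k
      have h3 := hsum l k
      rw [hsplit]
      nlinarith
    · obtain ⟨m, rfl⟩ : ∃ m, n = 1 + m := ⟨n - 1, by omega⟩
      have h1 := ih m (by omega) (1 + k)
      have h2 := hsub 1 m k
      have h3 := hg0 1 k
      rw [hsplit]
      have h4 : ∑ j ∈ Finset.range 1, A.indicator (1 : Ω → ℝ) (S^[j + k] x) = 0 := by
        simp [hx]
      rw [h4, zero_add]
      linarith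

variable [MeasurableSpace Ω] {P : Measure Ω}

theorem ae_forall_iterate (hS : MeasurePreserving S P P) {p : Ω → Prop} (h : ∀ᵐ x ∂P, p x) :
    ∀ᵐ x ∂P, ∀ k : ℕ, p (S^[k] x) :=
  ae_all_iff.2 fun k => (hS.iterate k).quasiMeasurePreserving.ae h

variable [IsProbabilityMeasure P]

/-- If almost every point sees a block of growth rate at most `b`, then the mean growth rate is at
most `b`. -/
theorem mean_rate_le (hS : MeasurePreserving S P P) (hmeas : ∀ n, AEMeasurable (g n) P)
    (hint : ∀ n, Integrable (g n) P) (hg0 : ∀ᵐ x ∂P, ∀ n, g n x ≤ 0)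
    (hsub : ∀ᵐ x ∂P, ∀ m n, g (m + n) x ≤ g m x + g n (S^[m] x)) {a b : ℝ} (hb : b ≤ 0)
    (ha : ∀ n : ℕ, a * n ≤ ∫ x, g n x ∂P)
    (hfreq : ∀ᵐ x ∂P, ∃ l : ℕ, 1 ≤ l ∧ g l x ≤ b * l) : a ≤ b := by
  set A : ℕ → Set Ω := fun N => {x | ∃ l : ℕ, 1 ≤ l ∧ l ≤ N ∧ g l x ≤ b * l} with hAdef
  have hAm : ∀ N, NullMeasurableSet (A N) P := by
    intro N
    have : A N = ⋃ l ∈ Finset.Icc 1 N, {x | g l x ≤ b * l} := by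
      ext x
      simp [hAdef, and_assoc]
    rw [this]
    exact Finset.nullMeasurableSet_biUnion _ fun l _ =>
      nullMeasurableSet_le (hmeas l) aemeasurable_const
  have hmono : Monotone A := fun N N' h x ⟨l, h1, h2, h3⟩ => ⟨l, h1, h2.trans h, h3⟩
  have hone : P (⋃ N, A N) = 1 := by
    rw [← measure_univ (μ := P)]
    refine measure_congr (eventuallyEq_univ.2 ?_)
    filter_upwards [hfreq] with x ⟨l, h1, h2⟩
    exact Set.mem_iUnion.2 ⟨l, l, h1, le_rfl, h2⟩
  have hlim : Tendsto (fun N => P.real (A N)) atTop (𝓝 1) := by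
    have h1 := tendsto_measure_iUnion_atTop (μ := P) hmono
    rw [hone] at h1
    have h2 := (ENNReal.tendsto_toReal ENNReal.one_ne_top).comp h1
    rw [ENNReal.toReal_one] at h2
    exact h2
  have hbound : ∀ N, a ≤ b * P.real (A N) := by
    intro N
    have hindm : AEStronglyMeasurable ((A N).indicator (1 : Ω → ℝ)) P :=
      (aestronglyMeasurable_const (b := (1 : ℝ))).indicator₀ (hAm N)
    have hindi : Integrable ((A N).indicator (1 : Ω → ℝ)) P :=
      (integrable_const (1 : ℝ)).indicator₀ (hAm N)
    have hcomp : ∀ j, ∫ x, (A N).indicator (1 : Ω → ℝ) (S^[j] x) ∂P = P.real (A N) := by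
      intro j
      have h1 : ∫ x, (A N).indicator (1 : Ω → ℝ) x ∂P = P.real (A N) := by
        rw [integral_indicator₀ (hAm N)]
        simp
      rw [← h1]
      have := integral_map (hS.iterate j).measurable.aemeasurable
        (f := (A N).indicator (1 : Ω → ℝ)) (μ := P) (by rwa [(hS.iterate j).map_eq])
      rw [(hS.iterate j).map_eq] at this
      exact this.symm
    have hcompi : ∀ j, Integrable (fun x => (A N).indicator (1 : Ω → ℝ) (S^[j] x)) P := fun j =>
      (hS.iterate j).integrable_comp_of_integrable hindi
    -- Integrate the covering bound. Dividing by n and letting n → ∞ removes the boundary term, and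
    -- N → ∞ then brings P(A N) to 1.
    have hle : ∀ n : ℕ, a * n ≤ b * (n * P.real (A N) - N) := by
      intro n
      refine (ha n).trans ?_
      have : b * (n * P.real (A N) - N) =
          ∫ x, b * (∑ j ∈ Finset.range n, (A N).indicator 1 (S^[j] x) - N) ∂P := by
        rw [integral_const_mul, integral_sub (integrable_finsetSum _ fun j _ => hcompi j)
          (integrable_const _), integral_finsetSum _ fun j _ => hcompi j]
        simp [hcomp]
      rw [this]
      refine integral_mono_ae (hint n) (((integrable_finsetSum _ fun j _ => hcompi j).sub
        (integrable_const _)).const_mul b) ?_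
      filter_upwards [ae_forall_iterate hS hg0, ae_forall_iterate hS hsub] with x h1 h2
      have := le_of_greedy_cover (S := S) (g := g) (A := A N) hb (fun x hx => hx) (x := x)
        (fun n k => h1 k n) (fun m n k => by
          have := h2 k m n
          rwa [← Function.iterate_add_apply] at this) n 0
      simpa using this
    have h1 : Tendsto (fun n : ℕ => b * P.real (A N) - b * N * (n : ℝ)⁻¹) atTop
        (𝓝 (b * P.real (A N) - b * N * 0)) :=
      tendsto_const_nhds.sub (tendsto_const_nhds.mul tendsto_inv_atTop_nhds_zero_nat)
    rw [mul_zero, sub_zero] at h1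
    refine ge_of_tendsto h1 ?_
    filter_upwards [eventually_gt_atTop 0] with n hn
    have hn' : (0 : ℝ) < n := by exact_mod_cast hn
    have := hle n
    have h3 : b * P.real (A N) - b * N * (n : ℝ)⁻¹ = b * (n * P.real (A N) - N) / n := by
      field_simp
    rw [h3, le_div_iff₀ hn']
    exact this
  have := ge_of_tendsto' (tendsto_const_nhds.mul hlim) hbound
  linarith

/-- The lower half of the subadditive ergodic theorem. -/
theorem ae_eventually_ge (hS : Ergodic S P) (hmeas : ∀ n, AEMeasurable (g n) P)
    (hint : ∀ n, Integrable (g n) P) (hg0 : ∀ᵐ x ∂P, ∀ n, g n x ≤ 0)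
    (hsub : ∀ᵐ x ∂P, ∀ m n, g (m + n) x ≤ g m x + g n (S^[m] x)) {a b : ℝ}
    (ha : ∀ n : ℕ, a * n ≤ ∫ x, g n x ∂P) (hba : b < a) :
    ∀ᵐ x ∂P, ∀ᶠ n : ℕ in atTop, b * n ≤ g n x := by
  have ha0 : a ≤ 0 := by
    have h1 := ha 1
    have : ∫ x, g 1 x ∂P ≤ 0 := integral_nonpos_of_ae (by filter_upwards [hg0] with x hx using hx 1)
    simp only [Nat.cast_one, mul_one] at h1
    linarith
  -- points at which the lower growth rate is less than `c`
  set E : Set Ω := {x | ∃ q : ℕ, ∃ᶠ n : ℕ in atTop, g n x < (b - 1 / (q + 1) + (a - b) / 2) * n}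
    with hE
  set c := b + (a - b) / 2 with hc
  have hEm : NullMeasurableSet E P := by
    have : E = ⋃ q : ℕ, ⋂ N : ℕ, ⋃ n : ℕ, ⋃ (_ : N ≤ n),
        {x | g n x < (b - 1 / (q + 1) + (a - b) / 2) * n} := by
      ext x
      simp [hE, frequently_atTop]
    rw [this]
    exact .iUnion fun q => .iInter fun N => .iUnion fun n => .iUnion fun _ =>
      nullMeasurableSet_lt (hmeas n) aemeasurable_const
  -- Passing from Sx to x shifts n to n + 1. The margin 1/(q + 1) shrinks to 1/(q + 2), and the
  -- difference absorbs this shift for large n.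
  have hEinv : S ⁻¹' E ≤ᵐ[P] E := by
    filter_upwards [hsub, hg0] with x hx hx0
    rintro ⟨q, hq⟩
    refine ⟨q + 1, ?_⟩
    have hq1 : (1 : ℝ) / (((q + 1 : ℕ) : ℝ) + 1) < 1 / ((q : ℝ) + 1) := by
      refine one_div_lt_one_div_of_lt (by positivity) ?_
      push_cast
      linarith
    set r := 1 / ((q : ℝ) + 1) with hr
    set r' := (1 : ℝ) / (((q + 1 : ℕ) : ℝ) + 1) with hr'
    have hev : ∀ᶠ n : ℕ in atTop, -(b - r' + (a - b) / 2) ≤ (r - r') * n :=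
      (tendsto_natCast_atTop_atTop.const_mul_atTop (sub_pos.2 hq1)).eventually_ge_atTop _
    have h1 : ∃ᶠ n : ℕ in atTop, g (n + 1) x < (b - r' + (a - b) / 2) * ((n + 1 : ℕ) : ℝ) := by
      refine (hq.and_eventually hev).mono fun n ⟨h2, h3⟩ => ?_
      have h4 := hx 1 n
      rw [Nat.add_comm 1 n] at h4
      have h5 := hx0 1
      simp only [Function.iterate_one] at h4
      push_cast
      nlinarith
    exact (tendsto_add_atTop_nat 1).frequently h1
  rcases hS.ae_empty_or_univ_of_preimage_ae_le hEm hEinv with h | h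
  · have h' : ∀ᵐ x ∂P, x ∉ E := eventuallyEq_empty.1 h
    obtain ⟨q, hq⟩ := exists_nat_one_div_lt (show 0 < (a - b) / 2 by linarith)
    filter_upwards [h'] with x hx
    have h1 : ¬ ∃ᶠ n : ℕ in atTop, g n x < (b - 1 / (q + 1) + (a - b) / 2) * n :=
      fun h => hx ⟨q, h⟩
    rw [not_frequently] at h1
    filter_upwards [h1] with n hn
    push Not at hn
    refine le_trans ?_ hn
    exact mul_le_mul_of_nonneg_right (by linarith) (Nat.cast_nonneg n)
  -- If E had full measure, almost every point would see a block of rate at most the midpoint c,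
  -- forcing a ≤ c < a.
  · exfalso
    have h' : ∀ᵐ x ∂P, x ∈ E := eventuallyEq_univ.1 h
    have : a ≤ c := by
      refine mean_rate_le hS.toMeasurePreserving hmeas hint hg0 hsub (by linarith) ha ?_
      filter_upwards [h'] with x ⟨q, hq⟩
      obtain ⟨n, hn, hn1⟩ := (hq.and_eventually (eventually_ge_atTop 1)).exists
      refine ⟨n, hn1, hn.le.trans (mul_le_mul_of_nonneg_right ?_ (Nat.cast_nonneg n))⟩
      have : (0 : ℝ) < 1 / (q + 1) := by positivity
      linarith
    linarith

/-- The upper half of the pointwise ergodic theorem for bounded functions. -/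
theorem ae_eventually_birkhoffSum_le (hS : Ergodic S P) {f : Ω → ℝ} (hf : AEMeasurable f P)
    {K : ℝ} (hK : ∀ᵐ x ∂P, |f x| ≤ K) {b : ℝ} (hb : ∫ x, f x ∂P < b) :
    ∀ᵐ x ∂P, ∀ᶠ n : ℕ in atTop, ∑ j ∈ Finset.range n, f (S^[j] x) ≤ b * n := by
  have hfi : Integrable f P := Integrable.of_bound hf.aestronglyMeasurable K hK
  have hmp := hS.toMeasurePreserving
  have hci : ∀ j, Integrable (fun x => -f (S^[j] x) - K) P := fun j =>
    ((hmp.iterate j).integrable_comp_of_integrable hfi).neg.sub (integrable_const K)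
  have hcomp : ∀ j, ∫ x, f (S^[j] x) ∂P = ∫ x, f x ∂P := by
    intro j
    have := integral_map (hmp.iterate j).measurable.aemeasurable
      (f := f) (μ := P) (by rw [(hmp.iterate j).map_eq]; exact hf.aestronglyMeasurable)
    rw [(hmp.iterate j).map_eq] at this
    exact this.symm
  have hgi : ∀ n : ℕ, Integrable (fun x => ∑ j ∈ Finset.range n, (-f (S^[j] x) - K)) P := fun n =>
    integrable_finsetSum _ fun j _ => hci j
  -- Subtracting K makes the negated sum nonpositive; being additive, it is subadditive with
  -- equality.
  have key := ae_eventually_ge (g := fun n x => ∑ j ∈ Finset.range n, (-f (S^[j] x) - K)) hS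
    (fun n => (hgi n).aemeasurable) hgi ?_ ?_
    (a := -(∫ x, f x ∂P) - K) (b := -b - K) ?_ (by linarith)
  · filter_upwards [key] with x hx
    filter_upwards [hx] with n hn
    simp only [Finset.sum_sub_distrib, Finset.sum_neg_distrib, Finset.sum_const,
      Finset.card_range, nsmul_eq_mul] at hn
    linarith
  · filter_upwards [ae_forall_iterate hmp hK] with x hx n
    refine Finset.sum_nonpos fun j _ => ?_
    have := neg_le_of_abs_le (hx j)
    linarith
  · refine Eventually.of_forall fun x m n => le_of_eq ?_
    rw [Finset.sum_range_add]
    congr 1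
    refine Finset.sum_congr rfl fun j _ => ?_
    rw [← Function.iterate_add_apply, Nat.add_comm]
  · intro n
    refine le_of_eq ?_
    rw [integral_finsetSum _ fun j _ => hci j]
    have : ∀ j, ∫ x, (-f (S^[j] x) - K) ∂P = -(∫ x, f x ∂P) - K := by
      intro j
      have hi : Integrable (fun x => -f (S^[j] x)) P :=
        ((hmp.iterate j).integrable_comp_of_integrable hfi).neg
      rw [integral_sub hi (integrable_const K), integral_neg, hcomp]
      simp
    simp only [this, Finset.sum_const, Finset.card_range, nsmul_eq_mul]
    ring

/-- The upper half of the subadditive ergodic theorem. -/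
theorem ae_eventually_le (hS : Ergodic S P) (hmeas : ∀ n, AEMeasurable (g n) P)
    (hg0 : ∀ᵐ x ∂P, ∀ n, g n x ≤ 0)
    (hsub : ∀ᵐ x ∂P, ∀ m n, g (m + n) x ≤ g m x + g n (S^[m] x)) {N : ℕ} (hN : 1 ≤ N) {K : ℝ}
    (hK : ∀ᵐ x ∂P, |g N x| ≤ K) {b : ℝ} (hb : ∫ x, g N x ∂P < b * N) :
    ∀ᵐ x ∂P, ∀ᶠ n : ℕ in atTop, g n x ≤ b * n := by
  have hN' : (0 : ℝ) < N := by exact_mod_cast hN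
  -- The gap between b' and b later absorbs the replacement of n by n + N.
  obtain ⟨b', hb', hbb'⟩ : ∃ b' : ℝ, ∫ x, g N x ∂P < b' * N ∧ b' < b := by
    refine ⟨((∫ x, g N x ∂P) / N + b) / 2, ?_, ?_⟩
    · rw [← div_lt_iff₀ hN'] at hb ⊢
      linarith
    · rw [← div_lt_iff₀ hN'] at hb
      linarith
  filter_upwards [ae_eventually_birkhoffSum_le hS (hmeas N) hK hb',
    ae_forall_iterate hS.toMeasurePreserving hg0,
    hsub] with x hx h0 hs
  have hanti : ∀ n, g (n + 1) x ≤ g n x := by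
    intro n
    have h1 := hs n 1
    have h2 := h0 n 1
    linarith
  have hanti' : Antitone fun n => g n x := antitone_nat_of_succ_le hanti
  -- Summing over all N offsets brings in every iterate of S, so Birkhoff sums over S suffice and
  -- ergodicity of S^N, which may fail, is not needed. The induction replaces g_n by g_{n+N} at the
  -- cost g_N(S^n x).
  have hsum : ∀ n, ∑ r ∈ Finset.range N, g (n + r) x ≤ ∑ j ∈ Finset.range n, g N (S^[j] x) := by
    intro n
    induction n with
    | zero =>
      simp only [Finset.range_zero, Finset.sum_empty]
      exact Finset.sum_nonpos fun r _ => h0 0 _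
    | succ n ih =>
      rw [Finset.sum_range_succ _ n]
      have h1 := Finset.sum_range_succ (fun r => g (n + r) x) N
      rw [Finset.sum_range_succ'] at h1
      have h2 := hs n N
      have h3 : ∑ r ∈ Finset.range N, g (n + 1 + r) x = ∑ r ∈ Finset.range N, g (n + (r + 1)) x :=
        Finset.sum_congr rfl fun r _ => by rw [show n + 1 + r = n + (r + 1) by ring]
      rw [h3]
      simp only [add_zero] at h1
      linarith
  have hle : ∀ n, N * g (n + N) x ≤ ∑ j ∈ Finset.range n, g N (S^[j] x) := by
    intro n
    refine le_trans ?_ (hsum n)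
    have := Finset.card_nsmul_le_sum (Finset.range N) (fun r => g (n + r) x) (g (n + N) x)
      fun r hr => hanti' (by have := Finset.mem_range.1 hr; omega)
    simpa using this
  have hev : ∀ᶠ n : ℕ in atTop, -(b * N) ≤ (b - b') * n :=
    (tendsto_natCast_atTop_atTop.const_mul_atTop (sub_pos.2 hbb')).eventually_ge_atTop _
  have hfin : ∀ᶠ n : ℕ in atTop, g (n + N) x ≤ b * ((n + N : ℕ) : ℝ) := by
    filter_upwards [hx, hev] with n h1 h2
    have h3 := (hle n).trans h1
    push_cast
    have h4 : g (n + N) x ≤ b' * n := by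
      refine le_of_mul_le_mul_left ?_ hN'
      linarith
    linarith
  have := (tendsto_sub_atTop_nat N).eventually hfin
  filter_upwards [this, eventually_ge_atTop N] with n hn hnN
  rwa [Nat.sub_add_cancel hnN] at hn

/-- The subadditive ergodic theorem for nonpositive processes of at most linear growth. -/
theorem ae_tendsto_subadditive (hS : Ergodic S P) (hmeas : ∀ n, AEMeasurable (g n) P) {K : ℝ}
    (hK : ∀ᵐ x ∂P, ∀ n : ℕ, -(K * n) ≤ g n x) (hg0 : ∀ᵐ x ∂P, ∀ n, g n x ≤ 0)
    (hsub : ∀ᵐ x ∂P, ∀ m n, g (m + n) x ≤ g m x + g n (S^[m] x)) :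
    ∀ᵐ x ∂P, Tendsto (fun n : ℕ => g n x / n) atTop
      (𝓝 (⨅ n : ℕ, (∫ x, g (n + 1) x ∂P) / ((n + 1 : ℕ) : ℝ))) := by
  have habs : ∀ n, ∀ᵐ x ∂P, |g n x| ≤ K * n := fun n => by
    filter_upwards [hK, hg0] with x h1 h2
    rw [abs_of_nonpos (h2 n)]
    linarith [h1 n]
  have hint : ∀ n, Integrable (g n) P := fun n =>
    Integrable.of_bound (hmeas n).aestronglyMeasurable _ (habs n)
  set a := ⨅ n : ℕ, (∫ x, g (n + 1) x ∂P) / ((n + 1 : ℕ) : ℝ) with ha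
  have hbdd : BddBelow (Set.range fun n : ℕ => (∫ x, g (n + 1) x ∂P) / ((n + 1 : ℕ) : ℝ)) := by
    refine ⟨-K, ?_⟩
    rintro _ ⟨n, rfl⟩
    have hn : (0 : ℝ) < ((n + 1 : ℕ) : ℝ) := by positivity
    simp only
    rw [le_div_iff₀ hn]
    have := integral_mono_ae (integrable_const (-(K * ((n + 1 : ℕ) : ℝ)))) (hint (n + 1))
      (by filter_upwards [hK] with x hx using hx _)
    simp only [integral_const, probReal_univ, one_smul] at this
    linarith
  have hlow : ∀ n : ℕ, a * n ≤ ∫ x, g n x ∂P := by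
    intro n
    rcases n with _ | n
    · have : ∫ x, g 0 x ∂P = 0 := by
        refine integral_eq_zero_of_ae ?_
        filter_upwards [habs 0] with x hx
        simpa using hx
      simp [this]
    · rw [← le_div_iff₀ (by positivity)]
      exact ciInf_le hbdd n
  have h1 : ∀ᵐ x ∂P, ∀ q : ℕ, ∀ᶠ n : ℕ in atTop, (a - 1 / (q + 1)) * n ≤ g n x := by
    refine ae_all_iff.2 fun q => ae_eventually_ge hS hmeas hint hg0 hsub hlow ?_
    have : (0 : ℝ) < 1 / (q + 1) := by positivity
    linarith
  have h2 : ∀ᵐ x ∂P, ∀ q : ℕ, ∀ᶠ n : ℕ in atTop, g n x ≤ (a + 1 / (q + 1)) * n := by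
    refine ae_all_iff.2 fun q => ?_
    have hq : (0 : ℝ) < 1 / (q + 1) := by positivity
    obtain ⟨n, hn⟩ := exists_lt_of_ciInf_lt (show a < a + 1 / (q + 1) by linarith)
    rw [div_lt_iff₀ (by positivity)] at hn
    exact ae_eventually_le hS hmeas hg0 hsub (Nat.succ_le_succ (Nat.zero_le n)) (habs _) hn
  filter_upwards [h1, h2] with x hx1 hx2
  rw [Metric.tendsto_nhds]
  intro ε hε
  obtain ⟨q, hq⟩ := exists_nat_one_div_lt hε
  filter_upwards [hx1 q, hx2 q, eventually_gt_atTop 0] with n hn1 hn2 hn0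
  have hn : (0 : ℝ) < n := by exact_mod_cast hn0
  rw [← le_div_iff₀ hn] at hn1
  rw [← div_le_iff₀ hn] at hn2
  rw [Real.dist_eq, abs_lt]
  constructor <;> linarith

end Subadditive

/-! ### Submultiplicative processes and their exponential rate -/

section Submultiplicative

variable {Ω : Type*}

/-- The logarithm of a submultiplicative process, truncated at the rate `-K`. -/
noncomputable def truncLog (c : ℕ → Ω → ℝ) (K n : ℕ) (x : Ω) : ℝ :=
  Real.log (max (c n x) (Real.exp (-(K * n))))

theorem max_exp_pos (c : ℕ → Ω → ℝ) (K n : ℕ) (x : Ω) :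
    0 < max (c n x) (Real.exp (-(K * n))) :=
  lt_max_of_lt_right (Real.exp_pos _)

theorem neg_le_truncLog (c : ℕ → Ω → ℝ) (K n : ℕ) (x : Ω) : -(K * n : ℝ) ≤ truncLog c K n x := by
  rw [truncLog, Real.le_log_iff_exp_le (max_exp_pos c K n x)]
  exact le_max_right _ _

theorem truncLog_nonpos {c : ℕ → Ω → ℝ} (h1 : ∀ n x, c n x ≤ 1) (K n : ℕ) (x : Ω) :
    truncLog c K n x ≤ 0 := by
  refine Real.log_nonpos (max_exp_pos c K n x).le (max_le (h1 n x) (Real.exp_le_one_iff.2 ?_))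
  rw [neg_nonpos]
  positivity

variable [MeasurableSpace Ω] {P : Measure Ω}

/-- The exponential rate of a truncated submultiplicative process. -/
noncomputable def truncRate (P : Measure Ω) (c : ℕ → Ω → ℝ) (K : ℕ) : ℝ :=
  Real.exp (⨅ n : ℕ, (∫ x, truncLog c K (n + 1) x ∂P) / ((n + 1 : ℕ) : ℝ))

/-- The exponential rate of a submultiplicative process. -/
noncomputable def expRate (P : Measure Ω) (c : ℕ → Ω → ℝ) : ℝ := ⨅ K : ℕ, truncRate P c K

variable {c : ℕ → Ω → ℝ}

theorem aemeasurable_truncLog (hmeas : ∀ n, AEMeasurable (c n) P) (K n : ℕ) :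
    AEMeasurable (truncLog c K n) P :=
  Real.measurable_log.comp_aemeasurable ((hmeas n).max aemeasurable_const)

theorem expRate_nonneg (P : Measure Ω) (c : ℕ → Ω → ℝ) : 0 ≤ expRate P c :=
  Real.iInf_nonneg fun _ => (Real.exp_pos _).le

theorem expRate_le (P : Measure Ω) (c : ℕ → Ω → ℝ) (K : ℕ) : expRate P c ≤ truncRate P c K :=
  ciInf_le ⟨0, by rintro _ ⟨K, rfl⟩; exact (Real.exp_pos _).le⟩ K

theorem expRate_congr {c' : ℕ → Ω → ℝ}
    (h : ∀ K n, ∫ x, truncLog c K n x ∂P = ∫ x, truncLog c' K n x ∂P) :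
    expRate P c = expRate P c' := by
  simp only [expRate, truncRate, h]

/-- The witness is a measurable version of sup_n c_n/κ^n, almost surely finite because the n-th root
is eventually below κ. -/
theorem exists_measurable_bound (hmeas : ∀ n, AEMeasurable (c n) P) (h0 : ∀ n x, 0 ≤ c n x)
    {C κ : ℝ} (hC : 0 ≤ C) (hκ : C < κ)
    (hlim : ∀ᵐ x ∂P, Tendsto (fun n : ℕ => c n x ^ (1 / (n : ℝ))) atTop (𝓝 C)) :
    ∃ D : Ω → ℝ, Measurable D ∧ ∀ᵐ x ∂P, ∀ n, c n x ≤ D x * κ ^ n := by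
  have hκ0 : 0 < κ := hC.trans_lt hκ
  have hD : AEMeasurable (fun x => ⨆ n, c n x / κ ^ n) P :=
    AEMeasurable.iSup fun n => (hmeas n).div_const _
  refine ⟨hD.mk _, hD.measurable_mk, ?_⟩
  filter_upwards [hD.ae_eq_mk, hlim] with x hx hl n
  rw [← hx, ← div_le_iff₀ (pow_pos hκ0 n)]
  refine le_ciSup (f := fun n => c n x / κ ^ n) ?_ n
  have hev : ∀ᶠ n : ℕ in atTop, c n x / κ ^ n ≤ 1 := by
    filter_upwards [hl.eventually_lt_const hκ, eventually_gt_atTop 0] with n hn hn0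
    have hn' : (n : ℝ) ≠ 0 := by exact_mod_cast hn0.ne'
    rw [div_le_one (pow_pos hκ0 n)]
    have := pow_le_pow_left₀ (Real.rpow_nonneg (h0 n x) _) hn.le n
    rwa [← Real.rpow_natCast, ← Real.rpow_mul (h0 n x), one_div_mul_cancel hn',
      Real.rpow_one] at this
  exact (isBoundedUnder_of_eventually_le hev).bddAbove_range

variable [IsProbabilityMeasure P]

theorem integrable_truncLog (hmeas : ∀ n, AEMeasurable (c n) P) (h1 : ∀ n x, c n x ≤ 1)
    (K n : ℕ) : Integrable (truncLog c K n) P :=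
  Integrable.of_bound (aemeasurable_truncLog hmeas K n).aestronglyMeasurable (K * n)
    (Eventually.of_forall fun x => by
      rw [Real.norm_eq_abs, abs_of_nonpos (truncLog_nonpos h1 K n x)]
      linarith [neg_le_truncLog c K n x])

/-- Truncation at K = 1 suffices: the truncated logarithm is nonpositive and vanishes only where c =
1, since exp(-(n + 1)) < 1. Its mean is thus negative, and one negative mean makes the infimum
negative. -/
theorem expRate_lt_one (hmeas : ∀ n, AEMeasurable (c n) P) (h1 : ∀ n x, c n x ≤ 1) {n : ℕ}
    (hn : ¬ ∀ᵐ x ∂P, c (n + 1) x = 1) : expRate P c < 1 := by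
  refine (expRate_le P c 1).trans_lt (Real.exp_lt_one_iff.2 ?_)
  have hneg : ∫ x, truncLog c 1 (n + 1) x ∂P < 0 := by
    refine (integral_nonpos fun x => truncLog_nonpos h1 _ _ x).lt_of_ne fun h => hn ?_
    have h2 : ∫ x, -truncLog c 1 (n + 1) x ∂P = 0 := by rw [integral_neg, h, neg_zero]
    rw [integral_eq_zero_iff_of_nonneg (fun x => neg_nonneg.2 (truncLog_nonpos h1 _ _ x)) (integrable_truncLog hmeas h1 1 (n + 1)).neg] at h2
    filter_upwards [h2] with x hx
    have h3 : truncLog c 1 (n + 1) x = 0 := by simpa using hx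
    have h4 := Real.eq_one_of_pos_of_log_eq_zero (max_exp_pos c 1 (n + 1) x) h3
    have h5 : Real.exp (-(((1 : ℕ) : ℝ) * ((n + 1 : ℕ) : ℝ))) < 1 := by
      refine Real.exp_lt_one_iff.2 ?_
      rw [neg_lt_zero]
      positivity
    rcases max_choice (c (n + 1) x) (Real.exp (-(((1 : ℕ) : ℝ) * ((n + 1 : ℕ) : ℝ)))) with h | h
    · rw [← h, h4]
    · exact absurd (h ▸ h4) h5.ne
  refine lt_of_le_of_lt (ciInf_le ⟨-1, ?_⟩ n) (div_neg_of_neg_of_pos hneg (by positivity))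
  rintro _ ⟨m, rfl⟩
  simp only
  rw [le_div_iff₀ (by positivity)]
  have := integral_mono (integrable_const _) (integrable_truncLog hmeas h1 1 (m + 1))
    (neg_le_truncLog c 1 (m + 1))
  simp only [integral_const, probReal_univ, one_smul] at this
  push_cast at this ⊢
  linarith

variable {S : Ω → Ω}

/-- The subadditive ergodic theorem in multiplicative form. -/
theorem ae_tendsto_expRate (hS : Ergodic S P) (hmeas : ∀ n, AEMeasurable (c n) P)
    (h0 : ∀ n x, 0 ≤ c n x) (h1 : ∀ n x, c n x ≤ 1)
    (hsub : ∀ᵐ x ∂P, ∀ m n, c (m + n) x ≤ c m x * c n (S^[m] x)) :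
    ∀ᵐ x ∂P, Tendsto (fun n : ℕ => c n x ^ (1 / (n : ℝ))) atTop (𝓝 (expRate P c)) := by
  have hsub' : ∀ K : ℕ, ∀ᵐ x ∂P, ∀ m n,
      truncLog c K (m + n) x ≤ truncLog c K m x + truncLog c K n (S^[m] x) := by
    intro K
    filter_upwards [hsub] with x hx m n
    rw [truncLog, truncLog, truncLog,
      ← Real.log_mul (max_exp_pos _ _ _ _).ne' (max_exp_pos _ _ _ _).ne']
    refine Real.log_le_log (max_exp_pos _ _ _ _) (max_le ?_ ?_)
    · refine (hx m n).trans ?_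
      exact mul_le_mul (le_max_left _ _) (le_max_left _ _) (h0 _ _) (max_exp_pos _ _ _ _).le
    · have : Real.exp (-(K * ((m + n : ℕ) : ℝ))) =
          Real.exp (-(K * m)) * Real.exp (-(K * n)) := by
        rw [← Real.exp_add]
        push_cast
        ring_nf
      rw [this]
      exact mul_le_mul (le_max_right _ _) (le_max_right _ _) (Real.exp_pos _).le
        (max_exp_pos _ _ _ _).le
  have hlim : ∀ᵐ x ∂P, ∀ K : ℕ, Tendsto (fun n : ℕ => truncLog c K n x / n) atTop
      (𝓝 (⨅ n : ℕ, (∫ x, truncLog c K (n + 1) x ∂P) / ((n + 1 : ℕ) : ℝ))) :=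
    ae_all_iff.2 fun K => ae_tendsto_subadditive hS (aemeasurable_truncLog hmeas K)
      (Eventually.of_forall fun x n => neg_le_truncLog c K n x)
      (Eventually.of_forall fun x n => truncLog_nonpos h1 K n x) (hsub' K)
  filter_upwards [hlim] with x hx
  -- After n-th roots the truncation level is the constant exp(-K). A K nearly attaining the infimum
  -- gives the upper bound; an L with exp(-L) < ε gives the lower one, through max(y, z) ≤ y + z.
  have hmax : ∀ K : ℕ, Tendsto (fun n : ℕ => max (c n x ^ (1 / (n : ℝ))) (Real.exp (-K))) atTop
      (𝓝 (truncRate P c K)) := by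
    intro K
    refine ((Real.continuous_exp.tendsto _).comp (hx K)).congr' ?_
    filter_upwards [eventually_gt_atTop 0] with n hn
    have hn' : (0 : ℝ) < n := by exact_mod_cast hn
    have hmono : max (c n x ^ (1 / (n : ℝ))) (Real.exp (-(K * n)) ^ (1 / (n : ℝ))) =
        max (c n x) (Real.exp (-(K * n))) ^ (1 / (n : ℝ)) :=
      ((Real.monotoneOn_rpow_Ici_of_exponent_nonneg (one_div_nonneg.2 hn'.le)).map_max
        (h0 n x) (Real.exp_pos _).le).symm
    have he : Real.exp (-(K * n)) ^ (1 / (n : ℝ)) = Real.exp (-K) := by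
      rw [← Real.exp_mul]
      congr 1
      field_simp
    rw [← he, hmono, Real.rpow_def_of_pos (max_exp_pos c K n x), Function.comp, truncLog,
      div_eq_mul_one_div]
  rw [Metric.tendsto_nhds]
  intro ε hε
  obtain ⟨K, hK⟩ := exists_lt_of_ciInf_lt (show expRate P c < expRate P c + ε by linarith)
  obtain ⟨L, hL⟩ : ∃ L : ℕ, Real.exp (-L) < ε := by
    have : Tendsto (fun L : ℕ => Real.exp (-(L : ℝ))) atTop (𝓝 0) :=
      Real.tendsto_exp_neg_atTop_nhds_zero.comp tendsto_natCast_atTop_atTop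
    exact (this.eventually_lt_const hε).exists
  have hlow : expRate P c - ε + Real.exp (-L) < truncRate P c L := by
    have := expRate_le P c L
    linarith
  filter_upwards [(hmax K).eventually_lt_const hK, (hmax L).eventually_const_lt hlow] with n hn1 hn2
  have h3 : 0 ≤ c n x ^ (1 / (n : ℝ)) := Real.rpow_nonneg (h0 n x) _
  have h4 : max (c n x ^ (1 / (n : ℝ))) (Real.exp (-L)) ≤ c n x ^ (1 / (n : ℝ)) + Real.exp (-L) :=
    max_le (by linarith [Real.exp_pos (-(L : ℝ))]) (by linarith)
  have h5 := le_max_left (c n x ^ (1 / (n : ℝ))) (Real.exp (-K))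
  rw [Real.dist_eq, abs_lt]
  constructor <;> linarith

end Submultiplicative

/-! ### Integer powers of the automorphism -/

section Orbit

variable {Ω : Type*} [MeasurableSpace Ω] {P : Measure Ω} (T : Ω ≃ᵐ Ω)

theorem autPow_zero (ω : Ω) : autPow T 0 ω = ω := rfl

theorem autPow_autPow (m n : ℤ) (ω : Ω) : autPow T m (autPow T n ω) = autPow T (m + n) ω := by
  simp [autPow, zpow_add]

theorem iterate_eq_autPow (n : ℕ) (ω : Ω) : T^[n] ω = autPow T n ω := by
  rw [autPow, zpow_natCast, Equiv.Perm.coe_pow]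
  rfl

theorem iterate_symm_eq_autPow (n : ℕ) (ω : Ω) : T.symm^[n] ω = autPow T (-n) ω := by
  rw [autPow, zpow_neg, zpow_natCast, ← inv_pow, Equiv.Perm.coe_pow]
  rfl

theorem measurePreserving_autPow (hT : MeasurePreserving T P P) (n : ℤ) :
    MeasurePreserving (autPow T n) P P := by
  obtain ⟨n, rfl | rfl⟩ := n.eq_nat_or_neg
  · rw [← funext (iterate_eq_autPow T n)]
    exact hT.iterate n
  · rw [← funext (iterate_symm_eq_autPow T n)]
    exact (MeasurePreserving.symm T hT).iterate n

theorem ae_forall_autPow (hT : MeasurePreserving T P P) {p : Ω → Prop} (h : ∀ᵐ ω ∂P, p ω) :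
    ∀ᵐ ω ∂P, ∀ n : ℤ, p (autPow T n ω) :=
  ae_all_iff.2 fun n => (measurePreserving_autPow T hT n).quasiMeasurePreserving.ae h

theorem ergodic_symm {T : Ω ≃ᵐ Ω} (hT : Ergodic T P) : Ergodic T.symm P where
  toMeasurePreserving := MeasurePreserving.symm T hT.toMeasurePreserving
  aeconst_set s hs h := by
    refine hT.aeconst_set hs ?_
    conv_lhs => rw [← h]
    rw [← Set.preimage_comp]
    simp

end Orbit

/-! ### The cocycle of contraction constants -/

section QuantumProcess

variable {M : Type*} [CStarAlgebra M] [PartialOrder M] [StarOrderedRing M] {τ : M →ₚ[ℂ] ℂ}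
variable {Ω : Type*} [MeasurableSpace Ω] {P : Measure Ω} (T : Ω ≃ᵐ Ω) (γ : Ω → L1 τ → L1 τ)

theorem quantumProcessAux_eq (m : ℤ) (ω : Ω) (j : ℕ) :
    quantumProcessAux T γ m ω j = quantumProcessAux T γ 0 (autPow T m ω) j := by
  induction j with
  | zero => simp [quantumProcessAux, autPow_zero]
  | succ j ih =>
    simp only [quantumProcessAux, ih, autPow_autPow]
    congr 3
    ring

/-- The cocycle identity. Index j stands for j + 1 factors, whence the extra 1. -/
theorem quantumProcessAux_add (ω : Ω) (i j : ℕ) :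
    quantumProcessAux T γ 0 ω (i + j + 1) =
      quantumProcessAux T γ 0 (autPow T (j + 1) ω) i ∘ quantumProcessAux T γ 0 ω j := by
  induction i with
  | zero => simp [quantumProcessAux, autPow_autPow]
  | succ i ih =>
    rw [show i + 1 + j + 1 = (i + j + 1) + 1 by ring, quantumProcessAux, ih, quantumProcessAux,
      autPow_autPow, Function.comp_assoc]
    congr 3
    push_cast
    ring

theorem isRandomOperator_quantumProcessAux {γ : Ω → L1 τ → L1 τ} (hγ : IsRandomOperator P γ)
    (hT : MeasurePreserving T P P) (j : ℕ) :
    IsRandomOperator P fun ω => quantumProcessAux T γ 0 ω j := by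
  induction j with
  | zero => exact hγ.comp_measurePreserving (measurePreserving_autPow T hT 0)
  | succ j ih => exact (hγ.comp_measurePreserving (measurePreserving_autPow T hT _)).comp ih

/-- The contraction constant of the product of the first `n` maps along the orbit. -/
noncomputable def forwardConst : ℕ → Ω → ℝ
  | 0, _ => 1
  | n + 1, ω => contractionConst (quantumProcessAux T γ 0 ω n)

/-- The contraction constant of the product of the last `n` maps along the past orbit. -/
noncomputable def backwardConst (n : ℕ) (ω : Ω) : ℝ := forwardConst T γ n (autPow T (1 - n) ω)

theorem forwardConst_nonneg (n : ℕ) (ω : Ω) : 0 ≤ forwardConst T γ n ω := by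
  cases n
  · exact zero_le_one
  · exact contractionConst_nonneg _

theorem forwardConst_le_one (n : ℕ) (ω : Ω) : forwardConst T γ n ω ≤ 1 := by
  cases n
  · exact le_rfl
  · exact contractionConst_le_one _

theorem contractionConst_eq_forwardConst {m n : ℤ} (h : m ≤ n) (ω : Ω) :
    contractionConst (quantumProcess T γ n m ω) =
      forwardConst T γ (n - m + 1).toNat (autPow T m ω) := by
  rw [quantumProcess, quantumProcessAux_eq, show (n - m + 1).toNat = (n - m).toNat + 1 by omega]
  rfl

theorem contractionConst_eq_backwardConst {m n : ℤ} (h : m ≤ n) (ω : Ω) :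
    contractionConst (quantumProcess T γ n m ω) =
      backwardConst T γ (n - m + 1).toNat (autPow T n ω) := by
  rw [contractionConst_eq_forwardConst T γ h, backwardConst, autPow_autPow]
  congr 2
  omega

variable {T γ}

theorem ae_forwardConst_add_le (hγ : IsRandomOperator P γ) (hT : MeasurePreserving T P P) :
    ∀ᵐ ω ∂P, ∀ (k : ℤ) (m n : ℕ), forwardConst T γ (m + n) (autPow T k ω) ≤
      forwardConst T γ m (autPow T k ω) * forwardConst T γ n (autPow T (m + k) ω) := by
  have h : ∀ᵐ ω ∂P, ∀ (j : ℕ), IsFaithfulPositive (quantumProcessAux T γ 0 ω j) :=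
    ae_all_iff.2 fun j => (isRandomOperator_quantumProcessAux T hγ hT j).faithfulPositive
  filter_upwards [ae_forall_autPow T hT h] with ω hω k m n
  rcases m with _ | j
  · simp [forwardConst]
  rcases n with _ | i
  · simp [forwardConst]
  rw [show j + 1 + (i + 1) = (i + j + 1) + 1 by ring]
  simp only [forwardConst]
  rw [quantumProcessAux_add, autPow_autPow, mul_comm]
  push_cast
  exact (hω _ i).contractionConst_comp_le (hω _ j)

theorem ae_forwardConst_subadditive (hγ : IsRandomOperator P γ) (hT : MeasurePreserving T P P) :
    ∀ᵐ ω ∂P, ∀ m n : ℕ, forwardConst T γ (m + n) ω ≤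
      forwardConst T γ m ω * forwardConst T γ n (T^[m] ω) := by
  filter_upwards [ae_forwardConst_add_le hγ hT] with ω hω m n
  simpa [iterate_eq_autPow, autPow_zero] using hω 0 m n

theorem ae_backwardConst_subadditive (hγ : IsRandomOperator P γ) (hT : MeasurePreserving T P P) :
    ∀ᵐ ω ∂P, ∀ m n : ℕ, backwardConst T γ (m + n) ω ≤
      backwardConst T γ m ω * backwardConst T γ n (T.symm^[m] ω) := by
  filter_upwards [ae_forwardConst_add_le hγ hT] with ω hω m n
  -- The last m + n factors split into the n older ones, ending at time -m, and the m most recent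
  -- ones, so the roles of m and n are exchanged over T⁻¹.
  have h := hω (1 - (m + n : ℕ)) n m
  rw [iterate_symm_eq_autPow, backwardConst, backwardConst, backwardConst, autPow_autPow,
    mul_comm, Nat.add_comm m n]
  rw [Nat.add_comm m n] at h
  convert h using 4 <;> push_cast <;> ring

variable [TopologicalSpace.SeparableSpace (L1 τ)]

theorem aemeasurable_forwardConst (hγ : IsRandomOperator P γ) (hT : MeasurePreserving T P P)
    (n : ℕ) : AEMeasurable (forwardConst T γ n) P := by
  cases n
  · exact aemeasurable_const
  · exact (isRandomOperator_quantumProcessAux T hγ hT _).aemeasurable_contractionConst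

theorem aemeasurable_backwardConst (hγ : IsRandomOperator P γ) (hT : MeasurePreserving T P P)
    (n : ℕ) : AEMeasurable (backwardConst T γ n) P :=
  (aemeasurable_forwardConst hγ hT n).comp_quasiMeasurePreserving
    (measurePreserving_autPow T hT _).quasiMeasurePreserving

/-- For each fixed n the backward constant is the forward one composed with a power of T, and the
rate depends only on integrals at fixed n. -/
theorem expRate_backwardConst (hγ : IsRandomOperator P γ) (hT : MeasurePreserving T P P) :
    expRate P (backwardConst T γ) = expRate P (forwardConst T γ) := by
  refine expRate_congr fun K n => ?_
  have hS := measurePreserving_autPow T hT (1 - n)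
  have := integral_map hS.measurable.aemeasurable (f := truncLog (forwardConst T γ) K n) (μ := P)
    (by rw [hS.map_eq]
        exact (aemeasurable_truncLog (aemeasurable_forwardConst hγ hT) K n).aestronglyMeasurable)
  rw [hS.map_eq] at this
  exact this.symm

theorem aemeasurable_contractionConst_quantumProcess (hγ : IsRandomOperator P γ)
    (hT : MeasurePreserving T P P) (n m : ℤ) :
    AEMeasurable (fun ω => contractionConst (quantumProcess T γ n m ω)) P := by
  simp only [quantumProcess, quantumProcessAux_eq T γ m]
  exact ((isRandomOperator_quantumProcessAux T hγ hT _).comp_measurePreserving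
    (measurePreserving_autPow T hT m)).aemeasurable_contractionConst

end QuantumProcess

/-! ### Limits, random constants and strictness of the rate -/

section Asymptotics

variable {M : Type*} [CStarAlgebra M] [PartialOrder M] [StarOrderedRing M] {τ : M →ₚ[ℂ] ℂ}
  [TopologicalSpace.SeparableSpace (L1 τ)]
variable {Ω : Type*} [MeasurableSpace Ω] {P : Measure Ω} [IsProbabilityMeasure P] {T : Ω ≃ᵐ Ω}
  {γ : Ω → L1 τ → L1 τ}

theorem ae_tendsto_forwardConst (hγ : IsRandomOperator P γ) (hT : Ergodic T P) :
    ∀ᵐ ω ∂P, Tendsto (fun n : ℕ => forwardConst T γ n ω ^ (1 / (n : ℝ))) atTop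
      (𝓝 (expRate P (forwardConst T γ))) :=
  ae_tendsto_expRate hT (aemeasurable_forwardConst hγ hT.toMeasurePreserving)
    (forwardConst_nonneg T γ) (forwardConst_le_one T γ)
    (ae_forwardConst_subadditive hγ hT.toMeasurePreserving)

theorem ae_tendsto_backwardConst (hγ : IsRandomOperator P γ) (hT : Ergodic T P) :
    ∀ᵐ ω ∂P, Tendsto (fun n : ℕ => backwardConst T γ n ω ^ (1 / (n : ℝ))) atTop
      (𝓝 (expRate P (forwardConst T γ))) := by
  rw [← expRate_backwardConst hγ hT.toMeasurePreserving]
  exact ae_tendsto_expRate (ergodic_symm hT)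
    (aemeasurable_backwardConst hγ hT.toMeasurePreserving)
    (fun n ω => forwardConst_nonneg T γ n _) (fun n ω => forwardConst_le_one T γ n _)
    (ae_backwardConst_subadditive hγ hT.toMeasurePreserving)

theorem ae_tendsto_atTop (hγ : IsRandomOperator P γ) (hT : Ergodic T P) (m : ℤ) :
    ∀ᵐ ω ∂P, Tendsto (fun n : ℤ => contractionConst (quantumProcess T γ n m ω) ^
      (1 / ((n - m + 1 : ℤ) : ℝ))) atTop (𝓝 (expRate P (forwardConst T γ))) := by
  filter_upwards [ae_forall_autPow T hT.toMeasurePreserving (ae_tendsto_forwardConst hγ hT)]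
    with ω hω
  have h1 : Tendsto (fun n : ℤ => (n - m + 1).toNat) atTop atTop :=
    tendsto_atTop.2 fun b => by
      filter_upwards [eventually_ge_atTop (b + m)] with n hn
      omega
  refine ((hω m).comp h1).congr' ?_
  filter_upwards [eventually_ge_atTop m] with n hn
  have h2 : ((n - m + 1).toNat : ℤ) = n - m + 1 := Int.toNat_of_nonneg (by omega)
  rw [contractionConst_eq_forwardConst T γ hn,
    show ((n - m + 1 : ℤ) : ℝ) = ((n - m + 1).toNat : ℝ) by rw [← Int.cast_natCast, h2]]
  rfl

theorem ae_tendsto_atBot (hγ : IsRandomOperator P γ) (hT : Ergodic T P) (n : ℤ) :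
    ∀ᵐ ω ∂P, Tendsto (fun m : ℤ => contractionConst (quantumProcess T γ n m ω) ^
      (1 / ((n - m + 1 : ℤ) : ℝ))) atBot (𝓝 (expRate P (forwardConst T γ))) := by
  filter_upwards [ae_forall_autPow T hT.toMeasurePreserving (ae_tendsto_backwardConst hγ hT)]
    with ω hω
  have h1 : Tendsto (fun m : ℤ => (n - m + 1).toNat) atBot atTop :=
    tendsto_atTop.2 fun b => by
      filter_upwards [eventually_le_atBot (n - b)] with m hm
      omega
  refine ((hω n).comp h1).congr' ?_
  filter_upwards [eventually_le_atBot n] with m hm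
  have h2 : ((n - m + 1).toNat : ℤ) = n - m + 1 := Int.toNat_of_nonneg (by omega)
  rw [contractionConst_eq_backwardConst T γ hm,
    show ((n - m + 1 : ℤ) : ℝ) = ((n - m + 1).toNat : ℝ) by rw [← Int.cast_natCast, h2]]
  rfl

/-- One measurable D is transported along the orbit, so equivariance holds for every ω and not just
almost surely. -/
theorem exists_forward_bound (hγ : IsRandomOperator P γ) (hT : Ergodic T P) {κ : ℝ}
    (hκ : expRate P (forwardConst T γ) < κ) :
    ∃ D : ℤ → Ω → ℝ, (∀ k, Measurable (D k)) ∧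
      (∀ (k l : ℤ) (ω : Ω), D k (autPow T l ω) = D (k + l) ω) ∧
      ∀ᵐ ω ∂P, ∀ n k : ℤ, k ≤ n →
        contractionConst (quantumProcess T γ n k ω) ≤ D k ω * κ ^ (n - k + 1) := by
  obtain ⟨D, hD, hDω⟩ := exists_measurable_bound
    (aemeasurable_forwardConst hγ hT.toMeasurePreserving) (forwardConst_nonneg T γ)
    (expRate_nonneg P _) hκ (ae_tendsto_forwardConst hγ hT)
  refine ⟨fun k ω => D (autPow T k ω), fun k =>
    hD.comp (measurePreserving_autPow T hT.toMeasurePreserving k).measurable,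
    fun k l ω => by simp only [autPow_autPow], ?_⟩
  filter_upwards [ae_forall_autPow T hT.toMeasurePreserving hDω] with ω hω n k hkn
  have h2 : ((n - k + 1).toNat : ℤ) = n - k + 1 := Int.toNat_of_nonneg (by omega)
  have h3 := hω k (n - k + 1).toNat
  rwa [← zpow_natCast, h2, ← contractionConst_eq_forwardConst T γ hkn] at h3

theorem exists_backward_bound (hγ : IsRandomOperator P γ) (hT : Ergodic T P) {κ : ℝ}
    (hκ : expRate P (forwardConst T γ) < κ) :
    ∃ D : ℤ → Ω → ℝ, (∀ k, Measurable (D k)) ∧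
      (∀ (k l : ℤ) (ω : Ω), D k (autPow T l ω) = D (k + l) ω) ∧
      ∀ᵐ ω ∂P, ∀ k m : ℤ, m ≤ k →
        contractionConst (quantumProcess T γ k m ω) ≤ D k ω * κ ^ (k - m + 1) := by
  obtain ⟨D, hD, hDω⟩ := exists_measurable_bound
    (aemeasurable_backwardConst hγ hT.toMeasurePreserving)
    (fun n ω => forwardConst_nonneg T γ n _)
    (expRate_nonneg P _) hκ (ae_tendsto_backwardConst hγ hT)
  refine ⟨fun k ω => D (autPow T k ω), fun k =>
    hD.comp (measurePreserving_autPow T hT.toMeasurePreserving k).measurable,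
    fun k l ω => by simp only [autPow_autPow], ?_⟩
  filter_upwards [ae_forall_autPow T hT.toMeasurePreserving hDω] with ω hω k m hmk
  have h2 : ((k - m + 1).toNat : ℤ) = k - m + 1 := Int.toNat_of_nonneg (by omega)
  have h3 := hω k (k - m + 1).toNat
  rwa [← zpow_natCast, h2, ← contractionConst_eq_backwardConst T γ hmk] at h3

theorem ae_isBigO (hγ : IsRandomOperator P γ) (hT : Ergodic T P) {r : ℝ}
    (hr : expRate P (forwardConst T γ) < r) (k : ℤ) :
    ∀ᵐ ω ∂P, (fun n : ℤ => contractionConst (quantumProcess T γ n k ω))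
        =O[atTop] (fun n : ℤ => r ^ n) ∧
      (fun m : ℤ => contractionConst (quantumProcess T γ k m ω))
        =O[atBot] (fun m : ℤ => r ^ (-m)) := by
  have hr0 : 0 < r := (expRate_nonneg P _).trans_lt hr
  obtain ⟨D, -, -, hD⟩ := exists_forward_bound hγ hT hr
  obtain ⟨D', -, -, hD'⟩ := exists_backward_bound hγ hT hr
  filter_upwards [hD, hD'] with ω h1 h2
  constructor
  · refine Asymptotics.IsBigO.of_bound (D k ω * r ^ (-k + 1)) ?_
    filter_upwards [eventually_ge_atTop k] with n hn
    rw [Real.norm_of_nonneg (contractionConst_nonneg _), Real.norm_of_nonneg (by positivity),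
      mul_assoc, ← zpow_add₀ hr0.ne', show -k + 1 + n = n - k + 1 by ring]
    exact h1 n k hn
  · refine Asymptotics.IsBigO.of_bound (D' k ω * r ^ (k + 1)) ?_
    filter_upwards [eventually_le_atBot k] with m hm
    rw [Real.norm_of_nonneg (contractionConst_nonneg _), Real.norm_of_nonneg (by positivity),
      mul_assoc, ← zpow_add₀ hr0.ne', show k + 1 + -m = k - m + 1 by ring]
    exact h2 k m hm

/-- A rate of at least 1 forces every forward constant to be 1 almost surely, and by invariance at
every integer time, which leaves no strict contraction. -/
theorem expRate_forwardConst_lt_one (hγ : IsRandomOperator P γ) (hT : Ergodic T P)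
    (h : 0 < P {ω | ∃ n m : ℤ, m ≤ n ∧ IsSHC (quantumProcess T γ n m ω)}) :
    expRate P (forwardConst T γ) < 1 := by
  by_contra hC
  have hone : ∀ᵐ ω ∂P, ∀ j : ℕ, forwardConst T γ (j + 1) ω = 1 := by
    refine ae_all_iff.2 fun j => ?_
    by_contra hj
    exact hC (expRate_lt_one (aemeasurable_forwardConst hγ hT.toMeasurePreserving)
      (forwardConst_le_one T γ) hj)
  refine h.ne' (measure_eq_zero_iff_ae_notMem.2 ?_)
  filter_upwards [ae_forall_autPow T hT.toMeasurePreserving hone] with ω hω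
  rintro ⟨n, m, hmn, hs⟩
  rw [isSHC_iff, contractionConst_eq_forwardConst T γ hmn,
    show (n - m + 1).toNat = (n - m).toNat + 1 by omega, hω m] at hs
  exact lt_irrefl _ hs

end Asymptotics

/-! ### First contraction times as stopping times -/

section StoppingTime

/-- Attainment of the infimum turns "the first time is at most i" into a union over times up to i;
an empty set gives ⊤ and makes both sides false. -/
theorem sInf_coe_le_iff {ι : Type*} [ConditionallyCompleteLinearOrder ι] {t : Set ι}
    (hb : BddBelow t) (hmem : t.Nonempty → sInf t ∈ t) (i : ι) :
    sInf ((fun a : ι => (a : WithTop ι)) '' t) ≤ (i : WithTop ι) ↔ ∃ n ∈ t, n ≤ i := by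
  rcases t.eq_empty_or_nonempty with rfl | ht
  · simp
  · rw [← WithTop.coe_sInf' ht hb, WithTop.coe_le_coe]
    exact ⟨fun h => ⟨_, hmem ht, h⟩, fun ⟨n, hn, h⟩ => (csInf_le hb hn).trans h⟩

variable {M : Type*} [CStarAlgebra M] [PartialOrder M] [StarOrderedRing M] {τ : M →ₚ[ℂ] ℂ}
variable {Ω : Type*} [MeasurableSpace Ω] {P : Measure Ω} {T : Ω ≃ᵐ Ω} {γ : Ω → L1 τ → L1 τ}

theorem nuPlus_le_iff (k i : ℤ) (ω : Ω) :
    nuPlus T γ k ω ≤ i ↔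
      ∃ n ∈ Set.Icc k i, contractionConst (quantumProcess T γ n k ω) < 1 := by
  have h1 : nuPlus T γ k ω = sInf ((fun a : ℤ => (a : WithTop ℤ)) ''
      {n : ℤ | k ≤ n ∧ IsSHC (quantumProcess T γ n k ω)}) := by
    rw [nuPlus]
    congr 1
    ext x
    simp only [Set.mem_image, Set.mem_ofPred_eq, and_assoc, eq_comm]
  have hb : BddBelow {n : ℤ | k ≤ n ∧ IsSHC (quantumProcess T γ n k ω)} := ⟨k, fun n hn => hn.1⟩
  rw [h1, sInf_coe_le_iff hb fun h => Int.csInf_mem h hb]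
  simp only [Set.mem_ofPred_eq, Set.mem_Icc, isSHC_iff]
  exact exists_congr fun n => by tauto

theorem nuMinus_le_iff (k i : ℤ) (ω : Ω) :
    nuMinus T γ k ω ≤ ((OrderDual.toDual i : ℤᵒᵈ) : WithTop ℤᵒᵈ) ↔
      ∃ m ∈ Set.Icc i k, contractionConst (quantumProcess T γ k m ω) < 1 := by
  have h1 : nuMinus T γ k ω = sInf ((fun a : ℤᵒᵈ => (a : WithTop ℤᵒᵈ)) ''
      {m : ℤᵒᵈ | m.ofDual ≤ k ∧ IsSHC (quantumProcess T γ k m.ofDual ω)}) := by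
    rw [nuMinus]
    congr 1
    ext x
    simp only [Set.mem_image, Set.mem_ofPred_eq, and_assoc, eq_comm, OrderDual.exists,
      OrderDual.ofDual_toDual]
  have hb : BddBelow {m : ℤᵒᵈ | m.ofDual ≤ k ∧ IsSHC (quantumProcess T γ k m.ofDual ω)} :=
    ⟨OrderDual.toDual k, fun n hn => hn.1⟩
  -- In the dual order the infimum is a supremum of integers bounded above by k, hence attained.
  rw [h1, sInf_coe_le_iff hb fun h => Int.csSup_mem
    (s := OrderDual.toDual ⁻¹' {m : ℤᵒᵈ | m.ofDual ≤ k ∧ IsSHC (quantumProcess T γ k m.ofDual ω)})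
    h hb]
  simp only [Set.mem_ofPred_eq, Set.mem_Icc, isSHC_iff, OrderDual.exists, OrderDual.ofDual_toDual,
    OrderDual.toDual_le_toDual]
  exact exists_congr fun n => by tauto

theorem sigmaPlus_mono (k : ℤ) {n n' : ℤ} (h : n ≤ n') : sigmaPlus T γ n k ≤ sigmaPlus T γ n' k :=
  biSup_mono fun _ hj => Set.Icc_subset_Icc_right h hj

theorem sigmaMinus_mono (k : ℤ) {m m' : ℤ} (h : m' ≤ m) :
    sigmaMinus T γ k m ≤ sigmaMinus T γ k m' :=
  biSup_mono fun _ hj => Set.Icc_subset_Icc_left h hj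

theorem measurableSet_nuPlus_le (k n : ℤ) :
    MeasurableSet[sigmaPlus T γ n k] {ω | nuPlus T γ k ω ≤ n} := by
  have h : {ω | nuPlus T γ k ω ≤ n} = ⋃ j ∈ Set.Icc k n,
      {ω | contractionConst (quantumProcess T γ j k ω) < 1} := by
    ext ω
    simp only [Set.mem_ofPred_eq, nuPlus_le_iff, Set.mem_iUnion, exists_prop]
  rw [h]
  refine MeasurableSet.biUnion (Set.to_countable _) fun j hj => ?_
  exact le_iSup₂ (f := fun j (_ : j ∈ Set.Icc k n) => (borel ℝ).comap fun ω =>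
    contractionConst (quantumProcess T γ j k ω)) j hj _ ⟨Set.Iio 1, measurableSet_Iio, rfl⟩

theorem measurableSet_nuMinus_le (k m : ℤ) :
    MeasurableSet[sigmaMinus T γ k m]
      {ω | nuMinus T γ k ω ≤ ((OrderDual.toDual m : ℤᵒᵈ) : WithTop ℤᵒᵈ)} := by
  have h : {ω | nuMinus T γ k ω ≤ ((OrderDual.toDual m : ℤᵒᵈ) : WithTop ℤᵒᵈ)} =
      ⋃ j ∈ Set.Icc m k, {ω | contractionConst (quantumProcess T γ k j ω) < 1} := by
    ext ω
    simp only [Set.mem_ofPred_eq, nuMinus_le_iff, Set.mem_iUnion, exists_prop]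
  rw [h]
  refine MeasurableSet.biUnion (Set.to_countable _) fun j hj => ?_
  exact le_iSup₂ (f := fun j (_ : j ∈ Set.Icc m k) => (borel ℝ).comap fun ω =>
    contractionConst (quantumProcess T γ k j ω)) j hj _ ⟨Set.Iio 1, measurableSet_Iio, rfl⟩

/-- A root eventually below 1 excludes the value 1 for the constant, which is then strictly less
than 1. -/
theorem nuPlus_ne_top {C : ℝ} (hC : C < 1) {k : ℤ} {ω : Ω}
    (h : Tendsto (fun n : ℤ => contractionConst (quantumProcess T γ n k ω) ^
      (1 / ((n - k + 1 : ℤ) : ℝ))) atTop (𝓝 C)) : nuPlus T γ k ω ≠ ⊤ := by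
  obtain ⟨n, hn, hkn⟩ := ((h.eventually_lt_const hC).and (eventually_ge_atTop k)).exists
  have h1 : nuPlus T γ k ω ≤ n := by
    refine (nuPlus_le_iff k n ω).2 ⟨n, ⟨hkn, le_rfl⟩, ?_⟩
    refine (contractionConst_le_one _).lt_of_ne fun h1 => ?_
    rw [h1, Real.one_rpow] at hn
    exact lt_irrefl _ hn
  exact (h1.trans_lt (WithTop.coe_lt_top n)).ne

theorem nuMinus_ne_top {C : ℝ} (hC : C < 1) {k : ℤ} {ω : Ω}
    (h : Tendsto (fun m : ℤ => contractionConst (quantumProcess T γ k m ω) ^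
      (1 / ((k - m + 1 : ℤ) : ℝ))) atBot (𝓝 C)) : nuMinus T γ k ω ≠ ⊤ := by
  obtain ⟨m, hm, hmk⟩ := ((h.eventually_lt_const hC).and (eventually_le_atBot k)).exists
  have h1 : nuMinus T γ k ω ≤ ((OrderDual.toDual m : ℤᵒᵈ) : WithTop ℤᵒᵈ) := by
    refine (nuMinus_le_iff k m ω).2 ⟨m, ⟨le_rfl, hmk⟩, ?_⟩
    refine (contractionConst_le_one _).lt_of_ne fun h1 => ?_
    rw [h1, Real.one_rpow] at hm
    exact lt_irrefl _ hm
  exact (h1.trans_lt (WithTop.coe_lt_top _)).ne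

variable [TopologicalSpace.SeparableSpace (L1 τ)]

/-- Almost everywhere measurability is exactly measurability for the completed σ-algebra, which is
why the filtrations live there. -/
theorem comap_contractionConst_le (hγ : IsRandomOperator P γ) (hT : MeasurePreserving T P P)
    (n m : ℤ) : (borel ℝ).comap (fun ω => contractionConst (quantumProcess T γ n m ω)) ≤
      completedSpace P := by
  rintro _ ⟨s, hs, rfl⟩
  exact (aemeasurable_contractionConst_quantumProcess hγ hT n m).nullMeasurable hs

/-- The filtration generated by the contraction constants in forward time. -/
noncomputable def forwardFiltration (hγ : IsRandomOperator P γ) (hT : MeasurePreserving T P P)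
    (k : ℤ) : Filtration ℤ (completedSpace P) where
  seq n := sigmaPlus T γ n k
  mono' _ _ h := sigmaPlus_mono k h
  le' _ := iSup₂_le fun j _ => comap_contractionConst_le hγ hT j k

/-- The filtration generated by the contraction constants in backward time. -/
noncomputable def backwardFiltration (hγ : IsRandomOperator P γ) (hT : MeasurePreserving T P P)
    (k : ℤ) : Filtration ℤᵒᵈ (completedSpace P) where
  seq m := sigmaMinus T γ k m.ofDual
  mono' _ _ h := sigmaMinus_mono k h
  le' _ := iSup₂_le fun j _ => comap_contractionConst_le hγ hT k j

end StoppingTime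

end Hennion

theorem mainTheorem5
    {M : Type*} [CStarAlgebra M] [PartialOrder M] [StarOrderedRing M] [WStarAlgebra M]
    (τ : M →ₚ[ℂ] ℂ) (hτ : IsFaithfulNormalTracialState τ)
    [TopologicalSpace.SeparableSpace (L1 τ)]
    {Ω : Type*} [MeasurableSpace Ω] (P : Measure Ω) [IsProbabilityMeasure P]
    (T : Ω ≃ᵐ Ω) (hT : Ergodic T P)
    (γ : Ω → L1 τ → L1 τ)
    (hγ : IsRandomOperator P γ)
    (hSHC : 0 < P {ω | ∃ n m : ℤ, m ≤ n ∧
      IsSHC (quantumProcess T γ n m ω)}) :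
    ∃ C : ℝ, 0 ≤ C ∧ C < 1 ∧
      -- (1) exponential rate of the contraction constants
      (∀ m : ℤ, ∀ᵐ ω ∂P, Tendsto (fun n : ℤ =>
        contractionConst (quantumProcess T γ n m ω) ^
          (1 / ((n - m + 1 : ℤ) : ℝ))) atTop (𝓝 C)) ∧
      (∀ n : ℤ, ∀ᵐ ω ∂P, Tendsto (fun m : ℤ =>
        contractionConst (quantumProcess T γ n m ω) ^
          (1 / ((n - m + 1 : ℤ) : ℝ))) atBot (𝓝 C)) ∧
      -- (2) random constants
      (∀ κ : ℝ, C < κ → κ < 1 →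
        ∃ Dplus Dminus : ℤ → Ω → ℝ,
          (∀ k, Measurable (Dplus k)) ∧ (∀ k, Measurable (Dminus k)) ∧
          (∀ (k l : ℤ) (ω : Ω), Dplus k (autPow T l ω) = Dplus (k + l) ω) ∧
          (∀ (k l : ℤ) (ω : Ω), Dminus k (autPow T l ω) = Dminus (k + l) ω) ∧
          (∀ᵐ ω ∂P, ∀ n k : ℤ, k ≤ n →
            contractionConst (quantumProcess T γ n k ω) ≤
              Dplus k ω * κ ^ (n - k + 1)) ∧
          (∀ᵐ ω ∂P, ∀ k m : ℤ, m ≤ k →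
            contractionConst (quantumProcess T γ k m ω) ≤
              Dminus k ω * κ ^ (k - m + 1))) ∧
      (∃ r : ℝ, 0 < r ∧ r < 1 ∧ ∀ k : ℤ, ∀ᵐ ω ∂P,
        (fun n : ℤ => contractionConst (quantumProcess T γ n k ω))
          =O[atTop] (fun n : ℤ => r ^ n) ∧
        (fun m : ℤ => contractionConst (quantumProcess T γ k m ω))
          =O[atBot] (fun m : ℤ => r ^ (-m))) ∧
      -- (3) the first contraction times are almost surely finite stopping times
      (∀ k : ℤ,
        (∃ 𝓕 : Filtration ℤ (completedSpace P),
          (∀ n : ℤ, 𝓕 n = sigmaPlus T γ n k) ∧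
          IsStoppingTime 𝓕 (nuPlus T γ k)) ∧
        (∀ᵐ ω ∂P, nuPlus T γ k ω ≠ ⊤)) ∧
      (∀ k : ℤ,
        (∃ 𝓕 : Filtration ℤᵒᵈ (completedSpace P),
          (∀ m : ℤ, 𝓕 (OrderDual.toDual m) = sigmaMinus T γ k m) ∧
          IsStoppingTime 𝓕 (nuMinus T γ k)) ∧
        (∀ᵐ ω ∂P, nuMinus T γ k ω ≠ ⊤)) := by
  have hmp := hT.toMeasurePreserving
  have hC := expRate_forwardConst_lt_one hγ hT hSHC
  refine ⟨expRate P (forwardConst T γ), expRate_nonneg P _, hC, ae_tendsto_atTop hγ hT,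
    ae_tendsto_atBot hγ hT, fun κ hκ _ => ?_, ?_, fun k => ⟨⟨forwardFiltration hγ hmp k,
      fun _ => rfl, fun n => measurableSet_nuPlus_le k n⟩, ?_⟩,
    fun k => ⟨⟨backwardFiltration hγ hmp k, fun _ => rfl,
      fun m => measurableSet_nuMinus_le k m.ofDual⟩, ?_⟩⟩
  · obtain ⟨D, hD1, hD2, hD3⟩ := exists_forward_bound hγ hT hκ
    obtain ⟨D', hD1', hD2', hD3'⟩ := exists_backward_bound hγ hT hκ
    exact ⟨D, D', hD1, hD1', hD2, hD2', hD3, hD3'⟩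
  -- Any r strictly between C and 1 serves for all k and almost all ω; only the implied constants
  -- are random.
  · obtain ⟨r, hr, hr1⟩ := exists_between hC
    exact ⟨r, (expRate_nonneg P _).trans_lt hr, hr1, ae_isBigO hγ hT hr⟩
  · filter_upwards [ae_tendsto_atTop hγ hT k] with ω hω using nuPlus_ne_top hC hω
  · filter_upwards [ae_tendsto_atBot hγ hT k] with ω hω using nuMinus_ne_top hC hω
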